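/- Let $m,n\ge 2$ be integers and let $$T(m,0,n)=\sum_{r=1}^{\infty}\sum_{s=1}^{\infty}\frac{1}{r^{m}(r+s)^{n}}$$ (a convergent series). Let $\zeta(z)$ be the Riemann zeta function, let $\zeta(z,q)$ be the Hurwitz zeta function, i.e. the meromorphic continuation in $z$ of $\sum_{j\ge 0}(j+q)^{-z}$, and let $\zeta'(z,q)=\partial_z\zeta(z,q)$. Let $B_k(q)$ be the Bernoulli polynomials, given by $\frac{te^{qt}}{e^{t}-1}=\sum_{k\ge 0}B_k(q)\frac{t^{k}}{k!}$, and for integers $k\ge 1$ and $0<q<1$ put $A_k(q)=k\,\zeta'(1-k,q)$ and $K(q)=\log\sin\pi q$. Define $$I_{BB}(k,l)=\int_0^1 B_k(q)B_l(q)K(q)\,dq,\qquad I_{AB}(k,l)=\frac1\pi\int_0^1 A_k(q)B_l(q)K(q)\,dq,$$ $$I_{AA}(k,l)=\frac1{\pi^2}\int_0^1 A_k(q)A_l(q)K(q)\,dq,\qquad J_{AA}(k,l)=\frac1{\pi^2}\int_0^1 A_k(q)A_l(1-q)K(q)\,dq.$$ Then $$T(m,0,n)=\zeta(m)\zeta(n)-\tfrac12\zeta(m+n)+(-1)^{\lfloor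 (m+n)/2\rfloor}\frac{(2\pi)^{m+n-1}}{m!\,n!}\,\ell_2(m,n),$$ where (all integrals occurring being absolutely convergent) (a) for $m$ and $n$ even: $\ell_2(m,n)=m\,I_{AB}(m-1,n)+n\,I_{AB}(m,n-1)$; (b) for $m$ and $n$ odd: $\ell_2(m,n)=m\,I_{AB}(n,m-1)+n\,I_{AB}(n-1,m)$; (c) for $m$ odd and $n$ even: $\ell_2(m,n)=\tfrac12\left(m\,I_{BB}(m-1,n)+n\,I_{BB}(m,n-1)\right)$; (d) for $m$ even and $n$ odd: $\ell_2(m,n)=-m\,I_{AA}(m-1,n)-n\,I_{AA}(m,n-1)-m\,J_{AA}(m-1,n)+n\,J_{AA}(m,n-1)$. -/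

import Mathlib

noncomputable section

namespace Tornheim

/-- The general term `1 / (r^a s^b (r+s)^c)` of the Tornheim double series, where the indices
`r, s ≥ 1` are written as `p.1 + 1` and `p.2 + 1`. -/
def term (a b c : ℕ) (p : ℕ × ℕ) : ℝ :=
  1 / (((p.1 : ℝ) + 1) ^ a * ((p.2 : ℝ) + 1) ^ b * (((p.1 : ℝ) + 1) + ((p.2 : ℝ) + 1)) ^ c)

/-- The Tornheim sum `T(a,b,c) = ∑_{r ≥ 1} ∑_{s ≥ 1} 1 / (r^a s^b (r+s)^c)`. -/
def T (a b c : ℕ) : ℝ :=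
  ∑' r : ℕ, ∑' s : ℕ, term a b c (r, s)

/-- The Bernoulli function `A_k(q) = k ζ'(1-k, q)`, the derivative being taken in the first
argument of the Hurwitz zeta function `ζ(z,q)`. It is used for `k ≥ 1` and `0 < q < 1` only, where
Mathlib's `hurwitzZeta` (periodic in `q`) is the continuation of `∑_{n ≥ 0} (n+q)^{-z}`. -/
def A (k : ℕ) (q : ℝ) : ℂ :=
  (k : ℂ) * deriv (fun z : ℂ => HurwitzZeta.hurwitzZeta (q : UnitAddCircle) z) (1 - (k : ℂ))

/-- The Bernoulli polynomial `B_k(q)`, as a complex number. -/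
def B (k : ℕ) (q : ℝ) : ℂ :=
  ((bernoulliFun k q : ℝ) : ℂ)

/-- The kernel `K(q) = log sin πq`, as a complex number. -/
def K (q : ℝ) : ℂ :=
  ((Real.log (Real.sin (Real.pi * q)) : ℝ) : ℂ)

/-- The integrand `B_k(q) B_l(q) K(q)`. -/
def fBB (k l : ℕ) (q : ℝ) : ℂ := B k q * B l q * K q

/-- The integrand `A_k(q) B_l(q) K(q)`. -/
def fAB (k l : ℕ) (q : ℝ) : ℂ := A k q * B l q * K q

/-- The integrand `A_k(q) A_l(q) K(q)`. -/
def fAA (k l : ℕ) (q : ℝ) : ℂ := A k q * A l q * K q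

/-- The integrand `A_k(q) A_l(1-q) K(q)`. -/
def gAA (k l : ℕ) (q : ℝ) : ℂ := A k q * A l (1 - q) * K q

def I_BB (k l : ℕ) : ℂ := ∫ q in (0 : ℝ)..1, fBB k l q

def I_AB (k l : ℕ) : ℂ := 1 / (Real.pi : ℂ) * ∫ q in (0 : ℝ)..1, fAB k l q

def I_AA (k l : ℕ) : ℂ := 1 / (Real.pi : ℂ) ^ 2 * ∫ q in (0 : ℝ)..1, fAA k l q

def J_AA (k l : ℕ) : ℂ := 1 / (Real.pi : ℂ) ^ 2 * ∫ q in (0 : ℝ)..1, gAA k l q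

/-- The combination `ℓ₂(m,n)` of the basic integrals; the four branches are, in this order:
`m, n` even; `m, n` odd; `m` odd and `n` even; `m` even and `n` odd. -/
def ell₂ (m n : ℕ) : ℂ :=
  if Even m ∧ Even n then m * I_AB (m - 1) n + n * I_AB m (n - 1)
  else if Odd m ∧ Odd n then m * I_AB n (m - 1) + n * I_AB (n - 1) m
  else if Odd m ∧ Even n then 1 / 2 * (m * I_BB (m - 1) n + n * I_BB m (n - 1))
  else -(m * I_AA (m - 1) n) - n * I_AA m (n - 1) - m * J_AA (m - 1) n + n * J_AA m (n - 1)

/-- Convergence of an integral over `[0,1]`. -/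
def Converges (f : ℝ → ℂ) : Prop :=
  IntervalIntegrable f MeasureTheory.volume 0 1

end Tornheim

end

noncomputable section

namespace Tornheim

open Complex Filter Topology HurwitzZeta MeasureTheory

/-! Write C_k(q) = ∑ cos(2πrq)/r^k and S_k(q) = ∑ sin(2πrq)/r^k, that is, `cosZeta q k` and `sinZeta
q k`. In C_{m-1} C_n - S_m S_{n-1} the pair (r,s) carries r^{-m} s^{-n} times r cos cos - s sin sin
= ½[(r+s) cos 2π(r+s)q + (r-s) cos 2π(r-s)q]. Since ∫₀¹ cos(2πjq) log sin πq dq = -1/(2|j|) for j ≠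
0, and the factor r-s removes the constant mode, integration against K leaves -(1 + sgn(r-s))/4 ·
r^{-m} s^{-n}. Twice the sum over all pairs is T(m,0,n) + ½ζ(m+n) - ζ(m)ζ(n), because T(m,0,n) is
the part r < s of the product series (`integral_zeta_mul_K`, `two_mul_tsum_pairTerm`).

It remains to express C_k and S_k by A_k and B_k. By the classical Fourier expansions B_k is a
multiple of C_k for even k and of S_k for odd k. The functional equation of the Hurwitz zeta
function has a trigonometric factor with a simple zero where it matters, so the part of A_k even
about 1/2 is a multiple of C_k for odd k, and the odd part a multiple of S_k for even k. K is
symmetric about 1/2, so integrals select these parts (`two_mul_integral_eq`), and the parities of m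
and n give the four cases.

The analytic difficulty is the index 1, which occurs when m = 2 or n = 2: there the series converge
only conditionally. They are regularised by ρ^r with ρ → 1. Summation by parts gives a bound
sin(πq)^{-1/4}, uniform in ρ; two such factors times log sin πq are integrable, so dominated
convergence applies. -/

/-- Summation by parts for series. -/
theorem tsum_mul_eq_tsum_partialSum_mul_sub {a w : ℕ → ℂ} {C : ℝ}
    (ha : ∀ n, ‖∑ j ∈ Finset.range n, a j‖ ≤ C) (hw : Tendsto w atTop (𝓝 0))
    (h₁ : Summable fun n => a n * w n)
    (h₂ : Summable fun n => (∑ j ∈ Finset.range (n + 1), a j) * (w n - w (n + 1))) :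
    ∑' n, a n * w n = ∑' n, (∑ j ∈ Finset.range (n + 1), a j) * (w n - w (n + 1)) := by
  have key : ∀ N, ∑ n ∈ Finset.range N, a n * w n =
      ∑ n ∈ Finset.range N, (∑ j ∈ Finset.range (n + 1), a j) * (w n - w (n + 1)) +
        (∑ j ∈ Finset.range N, a j) * w N := by
    intro N
    induction N with
    | zero => simp
    | succ N ih =>
      rw [Finset.sum_range_succ, ih, Finset.sum_range_succ (n := N), Finset.sum_range_succ (n := N)]
      ring
  have h0 : Tendsto (fun N => (∑ j ∈ Finset.range N, a j) * w N) atTop (𝓝 0) := by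
    refine squeeze_zero_norm (a := fun N => C * ‖w N‖) (fun N => ?_) ?_
    · rw [norm_mul]
      exact mul_le_mul_of_nonneg_right (ha N) (norm_nonneg _)
    · simpa using (hw.norm).const_mul C
  have l₁ := h₁.hasSum.tendsto_sum_nat
  have l₂ := h₂.hasSum.tendsto_sum_nat.add h0
  rw [add_zero] at l₂
  exact tendsto_nhds_unique l₁ (l₂.congr fun N => (key N).symm)

/-! ### Exponential sums and the continuation of the periodic zeta function -/

/-- The character `e^{2πi q (n+1)}`. -/
def character (q : ℝ) (n : ℕ) : ℂ := cexp (2 * Real.pi * I * q * ((n + 1 : ℕ) : ℂ))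

theorem norm_character (q : ℝ) (n : ℕ) : ‖character q n‖ = 1 := by
  have : (2 * Real.pi * I * q * ((n + 1 : ℕ) : ℂ)) = ((2 * Real.pi * q * (n + 1 : ℕ) : ℝ) : ℂ) * I := by
    push_cast; ring
  rw [character, this, norm_exp_ofReal_mul_I]

theorem character_eq_pow (q : ℝ) (n : ℕ) :
    character q n = cexp (2 * Real.pi * I * q) ^ (n + 1) := by
  rw [character, ← Complex.exp_nat_mul]; ring_nf

theorem continuous_character (n : ℕ) : Continuous fun q : ℝ => character q n := by
  unfold character; fun_prop

/-- The partial sums `∑_{j < n} e^{2πi q (j+1)}`. -/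
def characterSum (q : ℝ) (n : ℕ) : ℂ := ∑ j ∈ Finset.range n, character q j

theorem continuous_characterSum (n : ℕ) : Continuous fun q : ℝ => characterSum q n := by
  unfold characterSum
  exact continuous_finsetSum _ fun j _ => continuous_character j

theorem sin_pi_mul_pos {q : ℝ} (hq : q ∈ Set.Ioo (0 : ℝ) 1) : 0 < Real.sin (Real.pi * q) :=
  Real.sin_pos_of_pos_of_lt_pi (mul_pos Real.pi_pos hq.1) (by nlinarith [hq.2, Real.pi_pos])

/-- `1 - e^{2πiq} = 2 sin(πq) e^{iπ(q-1/2)}`. -/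
theorem one_sub_exp_eq (q : ℝ) :
    1 - cexp (2 * Real.pi * I * q) =
      ((2 * Real.sin (Real.pi * q) : ℝ) : ℂ) * cexp (((Real.pi * (q - 1 / 2) : ℝ) : ℂ) * I) := by
  have h1 : ((Real.pi * (q - 1 / 2) : ℝ) : ℂ) * I = Real.pi * q * I + -(Real.pi / 2 * I) := by
    push_cast; ring
  have h2 : cexp (2 * Real.pi * I * q) = cexp (Real.pi * q * I) * cexp (Real.pi * q * I) := by
    rw [← Complex.exp_add]; ring_nf
  have h3 : cexp (-(Real.pi * q) * I) * cexp (Real.pi * q * I) = 1 := by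
    rw [← Complex.exp_add]; ring_nf; simp
  rw [h1, h2, Complex.exp_add, Complex.exp_neg, Complex.exp_pi_div_two_mul_I]
  push_cast
  rw [Complex.sin, Complex.inv_I]
  linear_combination -h3 + (cexp (-(Real.pi * q) * I) * cexp (Real.pi * q * I) -
    cexp (Real.pi * q * I) * cexp (Real.pi * q * I)) * I_sq

theorem norm_one_sub_exp {q : ℝ} (hq : q ∈ Set.Ioo (0 : ℝ) 1) :
    ‖1 - cexp (2 * Real.pi * I * q)‖ = 2 * Real.sin (Real.pi * q) := by
  rw [one_sub_exp_eq, norm_mul, norm_exp_ofReal_mul_I, mul_one, norm_real, Real.norm_eq_abs,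
    abs_of_pos (by linarith [sin_pi_mul_pos hq])]

theorem norm_characterSum_le_natCast (q : ℝ) (n : ℕ) : ‖characterSum q n‖ ≤ n := by
  refine (norm_sum_le _ _).trans ?_
  simp [norm_character]

/-- Closed form of a geometric sum: the numerator is at most 2 and the denominator has modulus 2 sin
πq. -/
theorem norm_characterSum_le_inv_sin {q : ℝ} (hq : q ∈ Set.Ioo (0 : ℝ) 1) (n : ℕ) :
    ‖characterSum q n‖ ≤ (Real.sin (Real.pi * q))⁻¹ := by
  have hs := sin_pi_mul_pos hq
  have hn := norm_one_sub_exp hq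
  have hz : ‖cexp (2 * Real.pi * I * q)‖ = 1 := by
    have : (2 * Real.pi * I * q) = ((2 * Real.pi * q : ℝ) : ℂ) * I := by
      push_cast; ring
    rw [this, norm_exp_ofReal_mul_I]
  set z := cexp (2 * Real.pi * I * q) with hzdef
  have hne : z ≠ 1 := by
    intro h
    rw [h] at hn
    simp at hn
    linarith
  have : characterSum q n = z * ((z ^ n - 1) / (z - 1)) := by
    rw [← geom_sum_eq hne, Finset.mul_sum, characterSum]
    refine Finset.sum_congr rfl fun j _ => ?_
    rw [character_eq_pow, ← hzdef, pow_succ']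
  rw [this, norm_mul, hz, one_mul, norm_div, norm_sub_rev z, hn, div_le_iff₀ (by linarith)]
  have h2 : ‖z ^ n - 1‖ ≤ 2 := by
    refine (norm_sub_le _ _).trans ?_
    rw [norm_pow, hz]; norm_num
  have : (Real.sin (Real.pi * q))⁻¹ * (2 * Real.sin (Real.pi * q)) = 2 := by field_simp
  linarith

/-- Weighted geometric mean of the bounds n and 1/sin πq. The exponent 1/4 is small enough that two
such factors times a logarithm are integrable, and 3/4 is small enough for summation by parts to
converge at index 1. -/
theorem norm_characterSum_le_rpow {q : ℝ} (hq : q ∈ Set.Ioo (0 : ℝ) 1) (n : ℕ) :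
    ‖characterSum q n‖ ≤ (n : ℝ) ^ (3 / 4 : ℝ) * Real.sin (Real.pi * q) ^ (-(1 / 4) : ℝ) := by
  have hs := sin_pi_mul_pos hq
  have h0 := norm_nonneg (characterSum q n)
  calc ‖characterSum q n‖ = ‖characterSum q n‖ ^ (3 / 4 : ℝ) * ‖characterSum q n‖ ^ (1 / 4 : ℝ) := by
        rw [← Real.rpow_add_of_nonneg h0 (by norm_num) (by norm_num)]; norm_num
    _ ≤ (n : ℝ) ^ (3 / 4 : ℝ) * (Real.sin (Real.pi * q))⁻¹ ^ (1 / 4 : ℝ) := by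
        gcongr
        · exact norm_characterSum_le_natCast q n
        · exact norm_characterSum_le_inv_sin hq n
    _ = _ := by rw [Real.inv_rpow hs.le, Real.rpow_neg hs.le]

theorem norm_cpow_sub_cpow_succ_le (n : ℕ) {s : ℂ} (hs : 0 < s.re) :
    ‖((n + 1 : ℕ) : ℂ) ^ (-s) - ((n + 1 + 1 : ℕ) : ℂ) ^ (-s)‖ ≤
      ‖s‖ * ((n + 1 : ℕ) : ℝ) ^ (-s.re - 1) := by
  have hs0 : -s ≠ 0 := by
    intro h; rw [neg_eq_zero] at h; simp [h] at hs
  have hpos : (0 : ℝ) < ((n + 1 : ℕ) : ℝ) := by positivity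
  have := Convex.norm_image_sub_le_of_norm_hasDerivWithin_le
    (f := fun y : ℝ => (y : ℂ) ^ (-s)) (f' := fun x : ℝ => -s * (x : ℂ) ^ (-s - 1))
    (s := Set.Icc ((n + 1 : ℕ) : ℝ) ((n + 1 + 1 : ℕ) : ℝ))
    (x := ((n + 1 + 1 : ℕ) : ℝ)) (y := ((n + 1 : ℕ) : ℝ))
    (C := ‖s‖ * ((n + 1 : ℕ) : ℝ) ^ (-s.re - 1))
    (fun x hx => (hasDerivAt_ofReal_cpow_const (hpos.trans_le hx.1).ne' hs0).hasDerivWithinAt)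
    (fun x hx => ?_) (convex_Icc _ _) (by simp) (by simp)
  · simpa using this
  · have hx0 : 0 < x := hpos.trans_le hx.1
    rw [norm_mul, norm_neg, norm_cpow_eq_rpow_re_of_pos hx0]
    refine mul_le_mul_of_nonneg_left ?_ (norm_nonneg _)
    simpa using Real.rpow_le_rpow_of_nonpos hpos hx.1 (by linarith : -s.re - 1 ≤ 0)

theorem summable_succ_rpow : Summable fun n : ℕ => ((n + 1 : ℕ) : ℝ) ^ (-(9 / 8) : ℝ) :=
  (summable_nat_add_iff (f := fun n : ℕ => (n : ℝ) ^ (-(9 / 8) : ℝ)) 1).2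
    (Real.summable_nat_rpow.2 (by norm_num))

/-- The exponents add up to 3/4 - Re s - 1 < -9/8 when Re s > 7/8, so the bound is summable
uniformly in s apart from the factor ‖s‖. -/
theorem norm_characterSum_mul_cpow_le {q : ℝ} (hq : q ∈ Set.Ioo (0 : ℝ) 1) {s : ℂ}
    (hs : 7 / 8 < s.re) (n : ℕ) :
    ‖characterSum q (n + 1) * (((n + 1 : ℕ) : ℂ) ^ (-s) - ((n + 1 + 1 : ℕ) : ℂ) ^ (-s))‖ ≤
      ‖s‖ * Real.sin (Real.pi * q) ^ (-(1 / 4) : ℝ) * ((n + 1 : ℕ) : ℝ) ^ (-(9 / 8) : ℝ) := by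
  have hsin := sin_pi_mul_pos hq
  have hn : (0 : ℝ) < ((n + 1 : ℕ) : ℝ) := by positivity
  rw [norm_mul]
  calc _ ≤ (((n + 1 : ℕ) : ℝ) ^ (3 / 4 : ℝ) * Real.sin (Real.pi * q) ^ (-(1 / 4) : ℝ)) *
        (‖s‖ * ((n + 1 : ℕ) : ℝ) ^ (-s.re - 1)) :=
        mul_le_mul (norm_characterSum_le_rpow hq _) (norm_cpow_sub_cpow_succ_le n (by linarith))
          (norm_nonneg _) (by positivity)
    _ = ‖s‖ * Real.sin (Real.pi * q) ^ (-(1 / 4) : ℝ) *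
        (((n + 1 : ℕ) : ℝ) ^ (3 / 4 + (-s.re - 1) : ℝ)) := by
        rw [Real.rpow_add hn]; ring
    _ ≤ _ := by
        gcongr
        · simp
        · linarith

theorem coe_ne_zero_of_mem_Ioo {q : ℝ} (hq : q ∈ Set.Ioo (0 : ℝ) 1) : (q : UnitAddCircle) ≠ 0 := by
  intro h
  rw [AddCircle.coe_eq_zero_iff] at h
  obtain ⟨n, hn⟩ := h
  simp at hn
  have h1 : (0 : ℝ) < n := hn ▸ hq.1
  have h2 : (n : ℝ) < 1 := hn ▸ hq.2
  have h1' : 0 < n := by exact_mod_cast h1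
  have h2' : n < 1 := by exact_mod_cast h2
  omega

theorem expZeta_eq_tsum_of_one_lt_re (q : ℝ) {s : ℂ} (hs : 1 < s.re) :
    HasSum (fun n : ℕ => character q n * ((n + 1 : ℕ) : ℂ) ^ (-s)) (expZeta q s) := by
  have h := hasSum_expZeta_of_one_lt_re q hs
  rw [← hasSum_nat_add_iff' 1] at h
  have hs0 : s ≠ 0 := by rintro rfl; simp at hs; linarith
  simp only [Finset.range_one, Finset.sum_singleton, Nat.cast_zero, zero_cpow hs0, div_zero,
    sub_zero] at h
  refine h.congr_fun fun n => ?_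
  rw [character, cpow_neg, div_eq_mul_inv]

theorem tendsto_succ_cpow_neg {s : ℂ} (hs : 0 < s.re) :
    Tendsto (fun n : ℕ => ((n + 1 : ℕ) : ℂ) ^ (-s)) atTop (𝓝 0) := by
  rw [tendsto_zero_iff_norm_tendsto_zero]
  have h : Tendsto (fun n : ℕ => ((n + 1 : ℕ) : ℝ) ^ (-s.re)) atTop (𝓝 0) :=
    (tendsto_rpow_neg_atTop hs).comp
      (tendsto_natCast_atTop_atTop.comp (tendsto_add_atTop_nat 1))
  refine h.congr fun n => ?_
  rw [norm_natCast_cpow_of_pos (Nat.succ_pos n), neg_re]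

/-- The series obtained from `∑ e^{2πiqn} n^{-s}` by summation by parts represents `expZeta` in a
half-plane that contains `1`. -/
theorem expZeta_eq_tsum_characterSum {q : ℝ} (hq : q ∈ Set.Ioo (0 : ℝ) 1) {s : ℂ}
    (hs : 7 / 8 < s.re) :
    expZeta q s = ∑' n : ℕ, characterSum q (n + 1) *
      (((n + 1 : ℕ) : ℂ) ^ (-s) - ((n + 1 + 1 : ℕ) : ℂ) ^ (-s)) := by
  have hsin := sin_pi_mul_pos hq
  set F : ℕ → ℂ → ℂ := fun n s => characterSum q (n + 1) *
      (((n + 1 : ℕ) : ℂ) ^ (-s) - ((n + 1 + 1 : ℕ) : ℂ) ^ (-s)) with hF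
  -- The ball bounds the factor ‖w‖ in the majorant; its radius is chosen so that both s and 2 lie
  -- inside. Near 2 the Dirichlet series converges absolutely, and the identity theorem carries the
  -- equality to s.
  set R : ℝ := ‖s‖ + 3
  set U : Set ℂ := {s : ℂ | 7 / 8 < s.re} ∩ Metric.ball 0 R with hU
  have hUo : IsOpen U := (isOpen_lt continuous_const continuous_re).inter Metric.isOpen_ball
  have hUc : Convex ℝ U := (convex_halfSpace_re_gt _).inter (convex_ball _ _)
  have hsU : s ∈ U := ⟨hs, by simp [R]⟩
  have h2U : (2 : ℂ) ∈ U := ⟨by norm_num, by simp [R]; linarith [norm_nonneg s]⟩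
  have hsum := summable_succ_rpow.mul_left (R * Real.sin (Real.pi * q) ^ (-(1 / 4) : ℝ))
  have hbd : ∀ i : ℕ, ∀ w ∈ U, ‖F i w‖ ≤
      R * Real.sin (Real.pi * q) ^ (-(1 / 4) : ℝ) * ((i + 1 : ℕ) : ℝ) ^ (-(9 / 8) : ℝ) := by
    intro i w hw
    refine (norm_characterSum_mul_cpow_le hq hw.1 i).trans ?_
    have : ‖w‖ ≤ R := by simpa using (Metric.mem_ball.1 hw.2).le
    gcongr
  have hdiff : DifferentiableOn ℂ (fun w => ∑' i, F i w) U := by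
    refine differentiableOn_tsum_of_summable_norm hsum (fun i => ?_) hUo hbd
    intro w _
    refine DifferentiableAt.differentiableWithinAt ?_
    have h1 : ((i + 1 : ℕ) : ℂ) ≠ 0 := by exact_mod_cast Nat.succ_ne_zero i
    have h2 : ((i + 1 + 1 : ℕ) : ℂ) ≠ 0 := by exact_mod_cast Nat.succ_ne_zero (i + 1)
    refine (differentiableAt_const _).mul (DifferentiableAt.sub ?_ ?_)
    · exact differentiableAt_id.neg.const_cpow (Or.inl h1)
    · exact differentiableAt_id.neg.const_cpow (Or.inl h2)
  have hE : Differentiable ℂ (expZeta q) :=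
    differentiable_expZeta_of_ne_zero (coe_ne_zero_of_mem_Ioo hq)
  refine AnalyticOnNhd.eqOn_of_preconnected_of_eventuallyEq (f := expZeta q)
    (hE.differentiableOn.analyticOnNhd hUo) (hdiff.analyticOnNhd hUo) hUc.isPreconnected h2U ?_ hsU
  have hnb : U ∩ {w : ℂ | 1 < w.re} ∈ 𝓝 (2 : ℂ) :=
    (hUo.inter (isOpen_lt continuous_const continuous_re)).mem_nhds ⟨h2U, by simp⟩
  filter_upwards [hnb] with w hw
  have hs1 := expZeta_eq_tsum_of_one_lt_re q hw.2
  rw [← hs1.tsum_eq]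
  refine tsum_mul_eq_tsum_partialSum_mul_sub (norm_characterSum_le_inv_sin hq)
    (tendsto_succ_cpow_neg (lt_trans one_pos hw.2)) hs1.summable ?_
  exact .of_norm_bounded hsum fun i => hbd i w hw.1

theorem exists_norm_expZeta_le : ∃ c : ℝ, 0 ≤ c ∧ ∀ q ∈ Set.Ioo (0 : ℝ) 1, ∀ s : ℂ, 7 / 8 < s.re →
    ‖expZeta q s‖ ≤ c * ‖s‖ * Real.sin (Real.pi * q) ^ (-(1 / 4) : ℝ) := by
  refine ⟨∑' n : ℕ, ((n + 1 : ℕ) : ℝ) ^ (-(9 / 8) : ℝ), tsum_nonneg fun n => by positivity,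
    fun q hq s hs => ?_⟩
  rw [expZeta_eq_tsum_characterSum hq hs]
  refine (tsum_of_norm_bounded (summable_succ_rpow.hasSum.mul_left
    (‖s‖ * Real.sin (Real.pi * q) ^ (-(1 / 4) : ℝ)))
    (norm_characterSum_mul_cpow_le hq hs)).trans_eq ?_
  ring

/-! ### Abel regularisation, uniformly in ρ -/

/-- The weight `ρ^{n+1} / (n+1)^k`. -/
def abelWeight (k : ℕ) (ρ : ℝ) (n : ℕ) : ℝ := ρ ^ (n + 1) / ((n + 1 : ℕ) : ℝ) ^ k

theorem abelWeight_nonneg {k : ℕ} {ρ : ℝ} (hρ : 0 ≤ ρ) (n : ℕ) : 0 ≤ abelWeight k ρ n := by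
  unfold abelWeight; positivity

theorem abelWeight_le_pow {k : ℕ} {ρ : ℝ} (hρ : 0 ≤ ρ) (n : ℕ) :
    abelWeight k ρ n ≤ ρ ^ (n + 1) := by
  unfold abelWeight
  refine div_le_self (by positivity) (one_le_pow₀ ?_)
  exact_mod_cast Nat.succ_pos n

theorem summable_abelWeight (k : ℕ) {ρ : ℝ} (hρ : ρ ∈ Set.Ico (0 : ℝ) 1) :
    Summable (abelWeight k ρ) :=
  .of_nonneg_of_le (abelWeight_nonneg hρ.1) (abelWeight_le_pow hρ.1)
    ((summable_nat_add_iff 1).2 (summable_geometric_of_lt_one hρ.1 hρ.2))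

/-- Each of 1, ρ, ..., ρ^n is at least ρ^{n+1}, and their sum times 1 - ρ is 1 - ρ^{n+1}. -/
theorem succ_mul_pow_mul_one_sub_le {ρ : ℝ} (hρ : ρ ∈ Set.Icc (0 : ℝ) 1) (n : ℕ) :
    ((n + 1 : ℕ) : ℝ) * (ρ ^ (n + 1) * (1 - ρ)) ≤ 1 := by
  have h : ∑ i ∈ Finset.range (n + 1), ρ ^ (n + 1) ≤ ∑ i ∈ Finset.range (n + 1), ρ ^ i :=
    Finset.sum_le_sum fun i hi =>
      pow_le_pow_of_le_one hρ.1 hρ.2 (Finset.mem_range.1 hi).le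
  have hg := geom_sum_mul_neg ρ (n + 1)
  rw [Finset.sum_const, Finset.card_range, nsmul_eq_mul] at h
  have := mul_le_mul_of_nonneg_right h (sub_nonneg.2 hρ.2)
  have hp : 0 ≤ ρ ^ (n + 1) := pow_nonneg hρ.1 _
  nlinarith

/-- The weights decrease in n. For k ≥ 2 the first weight alone is small enough; for k = 1 the
difference splits into a part from 1/N - 1/(N+1) and a part with 1 - ρ, which
`succ_mul_pow_mul_one_sub_le` controls without loss as ρ → 1. -/
theorem abs_abelWeight_sub_le {k : ℕ} (hk : 1 ≤ k) {ρ : ℝ} (hρ : ρ ∈ Set.Icc (0 : ℝ) 1) (n : ℕ) :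
    |abelWeight k ρ n - abelWeight k ρ (n + 1)| ≤ 2 * ((n + 1 : ℕ) : ℝ) ^ (-2 : ℝ) := by
  have hN : (1 : ℝ) ≤ ((n + 1 : ℕ) : ℝ) := by exact_mod_cast Nat.succ_pos n
  have hN2 : ((n + 1 + 1 : ℕ) : ℝ) = ((n + 1 : ℕ) : ℝ) + 1 := by push_cast; ring
  have hp0 : 0 ≤ ρ ^ (n + 1) := pow_nonneg hρ.1 _
  have hp1 : ρ ^ (n + 1) ≤ 1 := pow_le_one₀ hρ.1 hρ.2
  have hmono : abelWeight k ρ (n + 1) ≤ abelWeight k ρ n := by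
    unfold abelWeight
    refine div_le_div₀ hp0 (pow_le_pow_of_le_one hρ.1 hρ.2 (by omega)) (by positivity) ?_
    gcongr
    omega
  rw [abs_of_nonneg (sub_nonneg.2 hmono), Real.rpow_neg (by positivity),
    show ((2 : ℝ)) = ((2 : ℕ) : ℝ) by norm_num, Real.rpow_natCast]
  rcases Nat.lt_or_ge 1 k with h2 | h1
  · have h0 := abelWeight_nonneg (k := k) hρ.1 (n + 1)
    have h3 : abelWeight k ρ n ≤ (((n + 1 : ℕ) : ℝ) ^ 2)⁻¹ := by
      unfold abelWeight
      rw [div_eq_mul_inv]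
      calc _ ≤ 1 * (((n + 1 : ℕ) : ℝ) ^ 2)⁻¹ := by gcongr; exact h2
        _ = _ := one_mul _
    have h4 : 0 ≤ (((n + 1 : ℕ) : ℝ) ^ 2)⁻¹ := by positivity
    push_cast at h3 h4 ⊢
    linarith
  · obtain rfl : k = 1 := by omega
    have key := succ_mul_pow_mul_one_sub_le hρ n
    unfold abelWeight
    rw [hN2, pow_one, pow_one, pow_succ ρ (n + 1)]
    set N := ((n + 1 : ℕ) : ℝ)
    set p := ρ ^ (n + 1)
    have hNpos : 0 < N := by linarith
    have : p / N - p * ρ / (N + 1) = (p + N * (p * (1 - ρ))) / (N * (N + 1)) := by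
      field_simp; ring
    rw [this, div_le_iff₀ (by positivity)]
    have h5 : 2 * (N ^ 2)⁻¹ * (N * (N + 1)) = 2 + 2 / N := by field_simp
    have h6 : 0 ≤ 2 / N := by positivity
    push_cast
    rw [h5]
    linarith

/-- The regularised series `∑ ρ^n e^{2πiqn} / n^k`. -/
def abelExp (k : ℕ) (ρ q : ℝ) : ℂ := ∑' n : ℕ, character q n * (abelWeight k ρ n : ℂ)

theorem summable_abelExp (k : ℕ) {ρ : ℝ} (hρ : ρ ∈ Set.Ico (0 : ℝ) 1) (q : ℝ) :
    Summable fun n : ℕ => character q n * (abelWeight k ρ n : ℂ) :=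
  .of_norm_bounded (summable_abelWeight k hρ) fun n => by
    rw [norm_mul, norm_character, one_mul, norm_real, Real.norm_eq_abs,
      abs_of_nonneg (abelWeight_nonneg hρ.1 n)]

theorem norm_characterSum_mul_abelWeight_le {q : ℝ} (hq : q ∈ Set.Ioo (0 : ℝ) 1) {k : ℕ}
    (hk : 1 ≤ k) {ρ : ℝ} (hρ : ρ ∈ Set.Icc (0 : ℝ) 1) (n : ℕ) :
    ‖characterSum q (n + 1) * ((abelWeight k ρ n : ℂ) - (abelWeight k ρ (n + 1) : ℂ))‖ ≤
      2 * Real.sin (Real.pi * q) ^ (-(1 / 4) : ℝ) * ((n + 1 : ℕ) : ℝ) ^ (-(9 / 8) : ℝ) := by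
  have hsin := sin_pi_mul_pos hq
  have hn : (0 : ℝ) < ((n + 1 : ℕ) : ℝ) := by positivity
  rw [norm_mul, ← ofReal_sub, norm_real, Real.norm_eq_abs]
  calc _ ≤ (((n + 1 : ℕ) : ℝ) ^ (3 / 4 : ℝ) * Real.sin (Real.pi * q) ^ (-(1 / 4) : ℝ)) *
        (2 * ((n + 1 : ℕ) : ℝ) ^ (-2 : ℝ)) :=
        mul_le_mul (norm_characterSum_le_rpow hq _) (abs_abelWeight_sub_le hk hρ n)
          (abs_nonneg _) (by positivity)
    _ = 2 * Real.sin (Real.pi * q) ^ (-(1 / 4) : ℝ) *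
        (((n + 1 : ℕ) : ℝ) ^ (3 / 4 + (-2) : ℝ)) := by
        rw [Real.rpow_add hn]; ring
    _ ≤ _ := by
        gcongr
        · simp
        · norm_num

theorem abelExp_eq_tsum_characterSum {q : ℝ} (hq : q ∈ Set.Ioo (0 : ℝ) 1) {k : ℕ}
    (hk : 1 ≤ k) {ρ : ℝ} (hρ : ρ ∈ Set.Ico (0 : ℝ) 1) :
    abelExp k ρ q = ∑' n : ℕ, characterSum q (n + 1) *
      ((abelWeight k ρ n : ℂ) - (abelWeight k ρ (n + 1) : ℂ)) := by
  refine tsum_mul_eq_tsum_partialSum_mul_sub (norm_characterSum_le_inv_sin hq) ?_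
    (summable_abelExp k hρ q) ?_
  · exact ((continuous_ofReal.tendsto 0).comp (summable_abelWeight k hρ).tendsto_atTop_zero)
  · exact .of_norm_bounded (summable_succ_rpow.mul_left _)
      fun i => norm_characterSum_mul_abelWeight_le hq hk ⟨hρ.1, hρ.2.le⟩ i

theorem exists_norm_abelExp_le : ∃ c : ℝ, 0 ≤ c ∧ ∀ k : ℕ, 1 ≤ k → ∀ ρ ∈ Set.Ico (0 : ℝ) 1,
    ∀ q ∈ Set.Ioo (0 : ℝ) 1, ‖abelExp k ρ q‖ ≤ c * Real.sin (Real.pi * q) ^ (-(1 / 4) : ℝ) := by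
  refine ⟨2 * ∑' n : ℕ, ((n + 1 : ℕ) : ℝ) ^ (-(9 / 8) : ℝ),
    mul_nonneg two_pos.le (tsum_nonneg fun n => by positivity), fun k hk ρ hρ q hq => ?_⟩
  rw [abelExp_eq_tsum_characterSum hq hk hρ]
  refine (tsum_of_norm_bounded (summable_succ_rpow.hasSum.mul_left _)
    (norm_characterSum_mul_abelWeight_le hq hk ⟨hρ.1, hρ.2.le⟩)).trans_eq ?_
  ring

theorem Ico_mem_nhdsWithin_one : Set.Ico (0 : ℝ) 1 ∈ 𝓝[<] (1 : ℝ) :=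
  Ico_mem_nhdsLT one_pos

theorem abelWeight_one_eq_cpow (k n : ℕ) :
    ((abelWeight k 1 n : ℝ) : ℂ) = ((n + 1 : ℕ) : ℂ) ^ (-(k : ℂ)) := by
  rw [cpow_neg, cpow_natCast, abelWeight, one_pow]; push_cast; simp

theorem tendsto_abelWeight (k n : ℕ) :
    Tendsto (fun ρ => abelWeight k ρ n) (𝓝[<] 1) (𝓝 (abelWeight k 1 n)) := by
  have : Continuous fun ρ => abelWeight k ρ n := by unfold abelWeight; fun_prop
  exact (this.tendsto 1).mono_left nhdsWithin_le_nhds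

/-- Abel summation of the Fourier series of `expZeta q k`. -/
theorem tendsto_abelExp {q : ℝ} (hq : q ∈ Set.Ioo (0 : ℝ) 1) {k : ℕ} (hk : 1 ≤ k) :
    Tendsto (fun ρ => abelExp k ρ q) (𝓝[<] 1) (𝓝 (expZeta q k)) := by
  have hk' : (7 / 8 : ℝ) < ((k : ℕ) : ℂ).re := by
    rw [natCast_re]
    have : (1 : ℝ) ≤ k := by exact_mod_cast hk
    linarith
  rw [expZeta_eq_tsum_characterSum hq hk']
  simp_rw [← abelWeight_one_eq_cpow]
  refine Tendsto.congr' (f₁ := fun ρ => ∑' n : ℕ, characterSum q (n + 1) *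
      ((abelWeight k ρ n : ℂ) - (abelWeight k ρ (n + 1) : ℂ))) ?_ ?_
  · filter_upwards [Ico_mem_nhdsWithin_one] with ρ hρ
    exact (abelExp_eq_tsum_characterSum hq hk hρ).symm
  · refine tendsto_tsum_of_dominated_convergence (summable_succ_rpow.mul_left
      (2 * Real.sin (Real.pi * q) ^ (-(1 / 4) : ℝ))) (fun n => ?_) ?_
    · exact ((((continuous_ofReal.tendsto _).comp (tendsto_abelWeight k n))).sub
        ((continuous_ofReal.tendsto _).comp (tendsto_abelWeight k (n + 1)))).const_mul _
    · filter_upwards [Ico_mem_nhdsWithin_one] with ρ hρ n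
      exact norm_characterSum_mul_abelWeight_le hq hk ⟨hρ.1, hρ.2.le⟩ n

/-! ### Closed forms at index 1 -/

theorem abelExp_one_eq_neg_log {ρ : ℝ} (hρ : ρ ∈ Set.Ico (0 : ℝ) 1) (q : ℝ) :
    abelExp 1 ρ q = -log (1 - ρ * cexp (2 * Real.pi * I * q)) := by
  have hz : ‖cexp (2 * Real.pi * I * q)‖ = 1 := by
    simpa [character] using norm_character q 0
  have h := Complex.hasSum_taylorSeries_neg_log (z := ρ * cexp (2 * Real.pi * I * q)) (by
    rw [norm_mul, hz, mul_one, norm_real, Real.norm_eq_abs, abs_of_nonneg hρ.1]; exact hρ.2)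
  rw [← hasSum_nat_add_iff' 1] at h
  simp only [Finset.range_one, Finset.sum_singleton, Nat.cast_zero, div_zero, sub_zero] at h
  rw [← h.tsum_eq, abelExp]
  refine tsum_congr fun n => ?_
  rw [character_eq_pow, abelWeight, mul_pow]
  push_cast
  ring

theorem log_one_sub_exp {q : ℝ} (hq : q ∈ Set.Ioo (0 : ℝ) 1) :
    log (1 - cexp (2 * Real.pi * I * q)) =
      (Real.log (2 * Real.sin (Real.pi * q)) : ℝ) + ((Real.pi * (q - 1 / 2) : ℝ) : ℂ) * I := by
  have hs := sin_pi_mul_pos hq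
  rw [one_sub_exp_eq, log_ofReal_mul (by positivity) (exp_ne_zero _), log_exp]
  · simp only [mul_im, ofReal_re, I_im, mul_one, ofReal_im, I_re, mul_zero, add_zero]
    nlinarith [hq.1, Real.pi_pos]
  · simp only [mul_im, ofReal_re, I_im, mul_one, ofReal_im, I_re, mul_zero, add_zero]
    nlinarith [hq.2, Real.pi_pos]

/-- Abel's limit theorem: the regularised series is -log(1 - ρ e^{2πiq}), which is continuous up to
ρ = 1 because q is not an integer. -/
theorem expZeta_one {q : ℝ} (hq : q ∈ Set.Ioo (0 : ℝ) 1) :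
    expZeta q 1 = -((Real.log (2 * Real.sin (Real.pi * q)) : ℝ) +
      ((Real.pi * (q - 1 / 2) : ℝ) : ℂ) * I) := by
  have h1 := tendsto_abelExp hq (le_refl 1)
  rw [Nat.cast_one] at h1
  refine tendsto_nhds_unique h1 ?_
  rw [← log_one_sub_exp hq]
  -- The real part is 1 - cos 2πq = 2 sin² πq > 0, away from the branch cut.
  have hmem : 1 - ((1 : ℝ) : ℂ) * cexp (2 * Real.pi * I * q) ∈ slitPlane := by
    left
    rw [ofReal_one, one_mul, one_sub_exp_eq, exp_mul_I, re_ofReal_mul, ← ofReal_cos, ← ofReal_sin]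
    simp only [add_re, ofReal_re, mul_re, I_re, mul_zero, ofReal_im, I_im]
    have hs := sin_pi_mul_pos hq
    have hc : Real.cos (Real.pi * (q - 1 / 2)) = Real.sin (Real.pi * q) := by
      rw [← Real.cos_sub_pi_div_two]; ring_nf
    rw [hc]
    nlinarith
  have hc : ContinuousAt (fun ρ : ℝ => -log (1 - (ρ : ℂ) * cexp (2 * Real.pi * I * q))) 1 := by
    refine ContinuousAt.neg (ContinuousAt.clog ?_ hmem)
    fun_prop
  have h2 := hc.tendsto.mono_left (nhdsWithin_le_nhds (s := Set.Iio (1 : ℝ)))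
  simp only [ofReal_one, one_mul] at h2
  refine h2.congr' ?_
  filter_upwards [Ico_mem_nhdsWithin_one] with ρ hρ
  exact (abelExp_one_eq_neg_log hρ q).symm

theorem coe_one_sub (q : ℝ) : ((1 - q : ℝ) : UnitAddCircle) = -(q : UnitAddCircle) := by
  have h : ((1 : ℝ) : UnitAddCircle) = 0 := AddCircle.coe_period 1
  rw [AddCircle.coe_sub, h, zero_sub]

theorem one_sub_mem_Ioo {q : ℝ} (hq : q ∈ Set.Ioo (0 : ℝ) 1) : 1 - q ∈ Set.Ioo (0 : ℝ) 1 :=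
  ⟨by linarith [hq.2], by linarith [hq.1]⟩

theorem sin_pi_mul_one_sub (q : ℝ) :
    Real.sin (Real.pi * (1 - q)) = Real.sin (Real.pi * q) := by
  rw [mul_sub, mul_one, Real.sin_pi_sub]

theorem sinZeta_one {q : ℝ} (hq : q ∈ Set.Ioo (0 : ℝ) 1) :
    sinZeta q 1 = -(Real.pi * (q - 1 / 2)) := by
  rw [sinZeta_eq, ← coe_one_sub, expZeta_one hq, expZeta_one (one_sub_mem_Ioo hq),
    sin_pi_mul_one_sub]
  push_cast
  field_simp
  ring

theorem cosZeta_one {q : ℝ} (hq : q ∈ Set.Ioo (0 : ℝ) 1) :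
    cosZeta q 1 = -(Real.log 2 + K q) := by
  rw [cosZeta_eq, ← coe_one_sub, expZeta_one hq, expZeta_one (one_sub_mem_Ioo hq),
    sin_pi_mul_one_sub, Real.log_mul two_ne_zero (sin_pi_mul_pos hq).ne', K]
  push_cast
  ring

/-! ### Integrability with mild endpoint singularities -/

theorem ae_mem_uIoc_imp_mem_Ioo : ∀ᵐ q : ℝ, q ∈ Set.uIoc (0 : ℝ) 1 → q ∈ Set.Ioo (0 : ℝ) 1 := by
  have : ∀ᵐ q : ℝ, q ≠ 1 := by simp [ae_iff, measure_singleton]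
  filter_upwards [this] with q hq h
  rw [Set.uIoc_of_le zero_le_one] at h
  exact ⟨h.1, lt_of_le_of_ne h.2 hq⟩

theorem ae_restrict_mem_Ioo :
    ∀ᵐ q ∂(volume.restrict (Set.uIoc (0 : ℝ) 1)), q ∈ Set.Ioo (0 : ℝ) 1 :=
  (ae_restrict_iff' measurableSet_uIoc).2 ae_mem_uIoc_imp_mem_Ioo

theorem measurable_K : Measurable K := by
  unfold K
  exact measurable_ofReal.comp (Real.measurable_log.comp (by fun_prop))

/-- The integrable majorant of all the integrands. -/
def majorant (q : ℝ) : ℝ :=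
  Real.sin (Real.pi * q) ^ (-(1 / 4) : ℝ) * Real.sin (Real.pi * q) ^ (-(1 / 4) : ℝ) * ‖K q‖

/-- Jordan's inequality sin x ≥ 2x/π on the half of the interval that contains q. -/
theorem min_le_sin_pi_mul {q : ℝ} (hq : q ∈ Set.Ioo (0 : ℝ) 1) :
    q ≤ Real.sin (Real.pi * q) ∨ 1 - q ≤ Real.sin (Real.pi * q) := by
  have key : ∀ x : ℝ, 0 < x → x ≤ 1 / 2 → x ≤ Real.sin (Real.pi * x) := by
    intro x h0 h1
    have := Real.mul_le_sin (x := Real.pi * x) (by positivity) (by nlinarith [Real.pi_pos])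
    have h2 : 2 / Real.pi * (Real.pi * x) = 2 * x := by field_simp
    linarith
  rcases le_total q (1 / 2) with h | h
  · exact Or.inl (key q hq.1 h)
  · right
    rw [← sin_pi_mul_one_sub]
    exact key _ (by linarith [hq.2]) (by linarith)

theorem measurable_sin_pi_mul : Measurable fun q : ℝ => Real.sin (Real.pi * q) := by fun_prop

theorem intervalIntegrable_sin_rpow {r : ℝ} (hr : -1 < r) (hr0 : r ≤ 0) :
    IntervalIntegrable (fun q : ℝ => Real.sin (Real.pi * q) ^ r) volume 0 1 := by
  have h1 : IntervalIntegrable (fun q : ℝ => q ^ r) volume 0 1 :=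
    intervalIntegral.intervalIntegrable_rpow' hr
  have h2 : IntervalIntegrable (fun q : ℝ => (1 - q) ^ r) volume 0 1 := by
    simpa using (h1.comp_sub_left 1).symm
  refine (h1.add h2).mono_fun' (measurable_sin_pi_mul.pow_const _).aestronglyMeasurable ?_
  filter_upwards [ae_restrict_mem_Ioo] with q hq
  have hs := sin_pi_mul_pos hq
  have hq1 : 0 < 1 - q := by linarith [hq.2]
  have hq0 := hq.1
  have a1 : 0 ≤ q ^ r := by positivity
  have a2 : 0 ≤ (1 - q) ^ r := by positivity
  rw [Real.norm_eq_abs, abs_of_nonneg (by positivity)]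
  rcases min_le_sin_pi_mul hq with h | h
  · linarith [Real.rpow_le_rpow_of_nonpos hq0 h hr0]
  · linarith [Real.rpow_le_rpow_of_nonpos hq1 h hr0]

/-- With x = sin πq the majorant is x^{-1/2} |log x|. Since |log x| x^{1/4} ≤ 4, it is at most 4
x^{-3/4}, which is still integrable. -/
theorem intervalIntegrable_majorant : IntervalIntegrable majorant volume 0 1 := by
  refine ((intervalIntegrable_sin_rpow (r := -(3 / 4)) (by norm_num) (by norm_num)).const_mul
    4).mono_fun' ?_ ?_
  · refine Measurable.aestronglyMeasurable ?_
    unfold majorant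
    exact ((measurable_sin_pi_mul.pow_const _).mul (measurable_sin_pi_mul.pow_const _)).mul
      measurable_K.norm
  · filter_upwards [ae_restrict_mem_Ioo] with q hq
    have hs := sin_pi_mul_pos hq
    have hlog := (Real.abs_log_mul_self_rpow_lt _ (1 / 4) hs (Real.sin_le_one _)
      (by norm_num)).le
    set x := Real.sin (Real.pi * q) with hx
    rw [abs_mul, abs_of_nonneg (by positivity : 0 ≤ x ^ (1 / 4 : ℝ))] at hlog
    have e : majorant q = |Real.log x| * x ^ (1 / 4 : ℝ) * x ^ (-(3 / 4) : ℝ) := by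
      rw [majorant, K, norm_real, Real.norm_eq_abs, ← hx, ← Real.rpow_add hs, mul_assoc,
        ← Real.rpow_add hs, mul_comm]
      norm_num
    have hm0 : 0 ≤ majorant q := by unfold majorant; positivity
    rw [Real.norm_eq_abs, abs_of_nonneg hm0, e]
    calc _ ≤ (1 / (1 / 4)) * x ^ (-(3 / 4) : ℝ) := by gcongr
      _ = _ := by norm_num

/-- Measurable functions on `(0,1)` with at most a `sin(πq)^{-1/4}` singularity at the ends. -/
def Mild (f : ℝ → ℂ) : Prop :=
  AEStronglyMeasurable f (volume.restrict (Set.uIoc (0 : ℝ) 1)) ∧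
    ∃ C, ∀ q ∈ Set.Ioo (0 : ℝ) 1, ‖f q‖ ≤ C * Real.sin (Real.pi * q) ^ (-(1 / 4) : ℝ)

theorem one_le_sin_rpow {q : ℝ} (hq : q ∈ Set.Ioo (0 : ℝ) 1) :
    1 ≤ Real.sin (Real.pi * q) ^ (-(1 / 4) : ℝ) :=
  Real.one_le_rpow_of_pos_of_le_one_of_nonpos (sin_pi_mul_pos hq) (Real.sin_le_one _) (by norm_num)

theorem norm_mul_mul_K_le {f g : ℂ} {a b q : ℝ}
    (hf : ‖f‖ ≤ a * Real.sin (Real.pi * q) ^ (-(1 / 4) : ℝ))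
    (hg : ‖g‖ ≤ b * Real.sin (Real.pi * q) ^ (-(1 / 4) : ℝ)) :
    ‖f * g * K q‖ ≤ a * b * majorant q := by
  rw [norm_mul, norm_mul]
  calc _ ≤ (a * Real.sin (Real.pi * q) ^ (-(1 / 4) : ℝ)) *
        (b * Real.sin (Real.pi * q) ^ (-(1 / 4) : ℝ)) * ‖K q‖ := by
        gcongr
        exact (norm_nonneg _).trans hf
    _ = _ := by unfold majorant; ring

theorem Mild.converges {f g : ℝ → ℂ} (hf : Mild f) (hg : Mild g) :
    Converges fun q => f q * g q * K q := by
  obtain ⟨hf, a, ha⟩ := hf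
  obtain ⟨hg, b, hb⟩ := hg
  refine (intervalIntegrable_majorant.const_mul (a * b)).mono_fun'
    ((hf.mul hg).mul measurable_K.aestronglyMeasurable) ?_
  filter_upwards [ae_restrict_mem_Ioo] with q hq
  exact norm_mul_mul_K_le (ha q hq) (hb q hq)

theorem Mild.add {f g : ℝ → ℂ} (hf : Mild f) (hg : Mild g) : Mild fun q => f q + g q := by
  obtain ⟨hf, a, ha⟩ := hf
  obtain ⟨hg, b, hb⟩ := hg
  refine ⟨hf.add hg, a + b, fun q hq => (norm_add_le _ _).trans ?_⟩
  rw [add_mul]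
  exact add_le_add (ha q hq) (hb q hq)

theorem Mild.const_mul {f : ℝ → ℂ} (hf : Mild f) (c : ℂ) : Mild fun q => c * f q := by
  obtain ⟨hf, a, ha⟩ := hf
  refine ⟨hf.const_mul c, ‖c‖ * a, fun q hq => ?_⟩
  rw [norm_mul, mul_assoc]
  exact mul_le_mul_of_nonneg_left (ha q hq) (norm_nonneg _)

theorem Mild.congr {f g : ℝ → ℂ} (hf : Mild f) (h : ∀ q ∈ Set.Ioo (0 : ℝ) 1, f q = g q) :
    Mild g := by
  obtain ⟨hf, a, ha⟩ := hf
  refine ⟨hf.congr ?_, a, fun q hq => h q hq ▸ ha q hq⟩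
  filter_upwards [ae_restrict_mem_Ioo] with q hq
  exact h q hq

theorem mild_of_continuous {f : ℝ → ℂ} (hf : Continuous f) : Mild f := by
  obtain ⟨C, hC⟩ := isCompact_Icc.exists_bound_of_continuousOn
    (hf.continuousOn (s := Set.Icc (0 : ℝ) 1))
  refine ⟨hf.aestronglyMeasurable, C, fun q hq => ?_⟩
  have h1 := hC q ⟨hq.1.le, hq.2.le⟩
  have h0 : 0 ≤ C := (norm_nonneg _).trans h1
  nlinarith [one_le_sin_rpow hq]

theorem mild_B (k : ℕ) : Mild (B k) :=
  mild_of_continuous (continuous_ofReal.comp (continuous_bernoulliFun k))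

theorem aestronglyMeasurable_expZeta_comp {s : ℂ} (hs : 7 / 8 < s.re) {φ : ℝ → ℝ}
    (hφ : Continuous φ) (hφm : ∀ q ∈ Set.Ioo (0 : ℝ) 1, φ q ∈ Set.Ioo (0 : ℝ) 1) :
    AEStronglyMeasurable (fun q : ℝ => expZeta (φ q : ℝ) s)
      (volume.restrict (Set.uIoc (0 : ℝ) 1)) := by
  refine aestronglyMeasurable_of_tendsto_ae atTop (f := fun (N : ℕ) (q : ℝ) =>
    ∑ n ∈ Finset.range N, characterSum (φ q) (n + 1) *
      (((n + 1 : ℕ) : ℂ) ^ (-s) - ((n + 1 + 1 : ℕ) : ℂ) ^ (-s))) (fun N => ?_) ?_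
  · refine Continuous.aestronglyMeasurable (continuous_finsetSum _ fun n _ => ?_)
    exact ((continuous_characterSum _).comp hφ).mul continuous_const
  · filter_upwards [ae_restrict_mem_Ioo] with q hq
    rw [expZeta_eq_tsum_characterSum (hφm q hq) hs]
    refine (Summable.hasSum ?_).tendsto_sum_nat
    exact .of_norm_bounded (summable_succ_rpow.mul_left _)
      fun i => norm_characterSum_mul_cpow_le (hφm q hq) hs i

theorem mild_expZeta {s : ℂ} (hs : 7 / 8 < s.re) : Mild fun q : ℝ => expZeta q s := by
  obtain ⟨c, -, hc⟩ := exists_norm_expZeta_le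
  exact ⟨aestronglyMeasurable_expZeta_comp hs continuous_id fun q hq => hq, c * ‖s‖,
    fun q hq => hc q hq s hs⟩

theorem mild_expZeta_neg {s : ℂ} (hs : 7 / 8 < s.re) :
    Mild fun q : ℝ => expZeta (-(q : UnitAddCircle)) s := by
  obtain ⟨c, -, hc⟩ := exists_norm_expZeta_le
  simp_rw [← coe_one_sub]
  refine ⟨aestronglyMeasurable_expZeta_comp hs (φ := fun q => 1 - q) (by fun_prop)
    fun q hq => one_sub_mem_Ioo hq, c * ‖s‖, fun q hq => ?_⟩
  rw [← sin_pi_mul_one_sub]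
  exact hc _ (one_sub_mem_Ioo hq) s hs

theorem mild_cosZeta {s : ℂ} (hs : 7 / 8 < s.re) : Mild fun q : ℝ => cosZeta q s :=
  (((mild_expZeta hs).add (mild_expZeta_neg hs)).const_mul (1 / 2)).congr fun q _ => by
    rw [cosZeta_eq]; ring

theorem mild_sinZeta {s : ℂ} (hs : 7 / 8 < s.re) : Mild fun q : ℝ => sinZeta q s :=
  (((mild_expZeta hs).add ((mild_expZeta_neg hs).const_mul (-1))).const_mul (1 / (2 * I))).congr
    fun q _ => by rw [sinZeta_eq]; ring

/-! ### The Bernoulli functions A_k are mild -/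

theorem ne_neg_natCast_of_re_pos {s : ℂ} (hs : 0 < s.re) (n : ℕ) : s ≠ -n := by
  rintro rfl
  rw [neg_re, natCast_re] at hs
  linarith [Nat.cast_nonneg (α := ℝ) n]

theorem hurwitzZeta_one_sub_eq {q : ℝ} (hq : q ∈ Set.Ioo (0 : ℝ) 1) {s : ℂ} (hs : 0 < s.re) :
    hurwitzZeta q (1 - s) = (2 * Real.pi) ^ (-s) * Gamma s * exp (-Real.pi * I * s / 2) *
      expZeta q s + (2 * Real.pi) ^ (-s) * Gamma s * exp (Real.pi * I * s / 2) *
        expZeta (-(q : UnitAddCircle)) s := by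
  rw [hurwitzZeta_one_sub _ (ne_neg_natCast_of_re_pos hs) (Or.inl (coe_ne_zero_of_mem_Ioo hq))]
  ring

theorem mild_hurwitzZeta_one_sub {s : ℂ} (hs : 7 / 8 < s.re) :
    Mild fun q : ℝ => hurwitzZeta q (1 - s) :=
  (((mild_expZeta hs).const_mul _).add ((mild_expZeta_neg hs).const_mul _)).congr fun q hq =>
    (hurwitzZeta_one_sub_eq hq (by linarith)).symm

theorem natCast_sub_le_re {k : ℕ} {s : ℂ} {r : ℝ} (hs : s ∈ Metric.closedBall (k : ℂ) r) :
    k - r ≤ s.re := by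
  have h1 := abs_re_le_norm (s - k)
  rw [mem_closedBall_iff_norm] at hs
  have h2 := abs_le.1 (h1.trans hs)
  rw [sub_re, natCast_re] at h2
  linarith [h2.1]

/-- Prepares Cauchy's estimate for the derivative at 1 - k. The radius 1/16 keeps the disc in Re s ≥
15/16, inside the half-plane Re s > 7/8 where the bounds on `expZeta` hold. -/
theorem exists_norm_hurwitzZeta_one_sub_le {k : ℕ} (hk : 1 ≤ k) :
    ∃ C : ℝ, ∀ q ∈ Set.Ioo (0 : ℝ) 1, ∀ s ∈ Metric.closedBall (k : ℂ) (1 / 16),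
      ‖hurwitzZeta q (1 - s)‖ ≤ C * Real.sin (Real.pi * q) ^ (-(1 / 4) : ℝ) := by
  have hk' : (1 : ℝ) ≤ k := by exact_mod_cast hk
  have hre : ∀ s ∈ Metric.closedBall (k : ℂ) (1 / 16), 7 / 8 < s.re := fun s hs => by
    linarith [natCast_sub_le_re hs]
  have hcont : ∀ c : ℂ, ContinuousOn (fun s : ℂ => (2 * Real.pi : ℂ) ^ (-s) * Gamma s *
      exp (c * I * s / 2)) (Metric.closedBall (k : ℂ) (1 / 16)) := by
    intro c s hs
    refine ContinuousAt.continuousWithinAt ?_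
    have h2pi : (2 * Real.pi : ℂ) ≠ 0 := by exact_mod_cast (by positivity : (2 * Real.pi : ℝ) ≠ 0)
    refine (ContinuousAt.mul ?_ ?_).mul (by fun_prop)
    · exact continuousAt_id.neg.const_cpow (Or.inl h2pi)
    · exact (differentiableAt_Gamma s
        (ne_neg_natCast_of_re_pos (by linarith [hre s hs]))).continuousAt
  obtain ⟨c, hc0, hc⟩ := exists_norm_expZeta_le
  obtain ⟨M, hM⟩ := (isCompact_closedBall _ _).exists_bound_of_continuousOn (hcont (-Real.pi))
  obtain ⟨N, hN⟩ := (isCompact_closedBall _ _).exists_bound_of_continuousOn (hcont Real.pi)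
  refine ⟨(M + N) * (c * (k + 1 / 16)), fun q hq s hs => ?_⟩
  have hs' := hre s hs
  have hns : ‖s‖ ≤ k + 1 / 16 := by
    have h1 := norm_add_le (s - k) k
    rw [mem_closedBall_iff_norm] at hs
    rw [sub_add_cancel, norm_natCast] at h1
    linarith
  have hsin : 0 < Real.sin (Real.pi * q) ^ (-(1 / 4) : ℝ) := by
    have := sin_pi_mul_pos hq; positivity
  have e1 : ‖expZeta q s‖ ≤ c * (k + 1 / 16) * Real.sin (Real.pi * q) ^ (-(1 / 4) : ℝ) :=
    (hc q hq s hs').trans (by gcongr)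
  have e2 : ‖expZeta (-(q : UnitAddCircle)) s‖ ≤
      c * (k + 1 / 16) * Real.sin (Real.pi * q) ^ (-(1 / 4) : ℝ) := by
    rw [← coe_one_sub]
    refine (hc _ (one_sub_mem_Ioo hq) s hs').trans ?_
    rw [sin_pi_mul_one_sub]
    gcongr
  rw [hurwitzZeta_one_sub_eq hq (by linarith)]
  refine (norm_add_le _ _).trans ?_
  rw [norm_mul _ (expZeta _ _), norm_mul _ (expZeta _ _)]
  have m1 := mul_le_mul (hM s hs) e1 (norm_nonneg _) ((norm_nonneg _).trans (hM s hs))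
  have m2 := mul_le_mul (hN s hs) e2 (norm_nonneg _) ((norm_nonneg _).trans (hN s hs))
  refine (add_le_add m1 m2).trans_eq ?_
  ring

theorem one_sub_natCast_ne_one {k : ℕ} (hk : 1 ≤ k) : (1 - (k : ℂ)) ≠ 1 := by
  intro h
  have : (k : ℂ) = 0 := by linear_combination -h
  norm_cast at this
  omega

/-- Measurability comes from difference quotients and the size from Cauchy's estimate on a circle of
radius 1/16 about 1 - k. The pole at 1 is at distance k ≥ 1 from the centre. -/
theorem mild_A {k : ℕ} (hk : 1 ≤ k) : Mild (A k) := by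
  have hk' : (1 : ℝ) ≤ k := by exact_mod_cast hk
  refine Mild.const_mul (f := fun q : ℝ =>
    deriv (fun z : ℂ => hurwitzZeta (q : UnitAddCircle) z) (1 - (k : ℂ))) ⟨?_, ?_⟩ k
  -- The increments -1/(N+1) are negative so that s = k + 1/(N+1) moves to the right and stays in Re
  -- s > 7/8.
  · refine aestronglyMeasurable_of_tendsto_ae atTop (f := fun (N : ℕ) (q : ℝ) =>
      (-(1 / ((N : ℂ) + 1)))⁻¹ • (hurwitzZeta q (1 - ((k : ℂ) + 1 / ((N : ℂ) + 1))) -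
        hurwitzZeta q (1 - (k : ℂ)))) (fun N => ?_) ?_
    · have h₁ : AEStronglyMeasurable
          (fun q : ℝ => hurwitzZeta q (1 - ((k : ℂ) + 1 / ((N : ℂ) + 1))))
          (volume.restrict (Set.uIoc (0 : ℝ) 1)) := by
        refine (mild_hurwitzZeta_one_sub ?_).1
        have : (1 : ℂ) / ((N : ℂ) + 1) = ((1 / ((N : ℝ) + 1) : ℝ) : ℂ) := by push_cast; rfl
        rw [this, add_re, natCast_re, ofReal_re]
        have : 0 < 1 / ((N : ℝ) + 1) := by positivity
        linarith
      exact (h₁.sub (mild_hurwitzZeta_one_sub (by rw [natCast_re]; linarith)).1).fun_const_smul _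
    · refine Eventually.of_forall fun q => ?_
      have hd := (differentiableAt_hurwitzZeta (q : UnitAddCircle)
        (one_sub_natCast_ne_one hk)).hasDerivAt
      rw [hasDerivAt_iff_tendsto_slope_zero] at hd
      have ht : Tendsto (fun N : ℕ => -(1 / ((N : ℂ) + 1))) atTop (𝓝[≠] 0) := by
        refine tendsto_nhdsWithin_iff.2 ⟨?_, Eventually.of_forall fun N => ?_⟩
        · simpa using (tendsto_one_div_add_atTop_nhds_zero_nat (𝕜 := ℂ)).neg
        · simpa using Nat.cast_add_one_ne_zero (R := ℂ) N
      refine (hd.comp ht).congr fun N => ?_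
      simp only [Function.comp_apply]
      congr 3
      ring
  · obtain ⟨C, hC⟩ := exists_norm_hurwitzZeta_one_sub_le hk
    refine ⟨C / (1 / 16), fun q hq => ?_⟩
    have := norm_deriv_le_of_forall_mem_sphere_norm_le (c := 1 - (k : ℂ)) (R := 1 / 16)
      (C := C * Real.sin (Real.pi * q) ^ (-(1 / 4) : ℝ))
      (f := fun z : ℂ => hurwitzZeta (q : UnitAddCircle) z) (by norm_num) ?_ fun z hz => ?_
    · refine this.trans_eq ?_
      ring
    · refine DifferentiableOn.diffContOnCl_ball (U := {z : ℂ | z ≠ 1}) (fun z hz => ?_) ?_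
      · exact (differentiableAt_hurwitzZeta _ hz).differentiableWithinAt
      · intro z hz h1
        rw [h1, mem_closedBall_iff_norm] at hz
        simp only [sub_sub_cancel, Complex.norm_natCast] at hz
        linarith
    · have := hC q hq (1 - z) (by
        rw [mem_sphere_iff_norm] at hz
        rw [mem_closedBall_iff_norm, norm_sub_rev]
        refine le_of_eq ?_
        rw [← hz]; congr 1; ring)
      simpa using this

theorem A_one_sub (k : ℕ) (q : ℝ) :
    A k (1 - q) = k * deriv (fun z : ℂ => hurwitzZeta (-(q : UnitAddCircle)) z) (1 - (k : ℂ)) := by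
  rw [A, coe_one_sub]

theorem Mild.comp_one_sub {f : ℝ → ℂ} (hf : Mild f) : Mild fun q => f (1 - q) := by
  obtain ⟨hf, a, ha⟩ := hf
  refine ⟨?_, a, fun q hq => ?_⟩
  · have hmp := (Measure.measurePreserving_sub_left (volume : Measure ℝ) 1).restrict_preimage
      (s := Set.uIoc (0 : ℝ) 1) measurableSet_uIoc
    -- Reflection exchanges the closed and the open end; the two intervals differ by a null set.
    have hset : (fun q : ℝ => 1 - q) ⁻¹' Set.uIoc (0 : ℝ) 1 =ᵐ[volume] Set.uIoc (0 : ℝ) 1 := by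
      have : (fun q : ℝ => 1 - q) ⁻¹' Set.uIoc (0 : ℝ) 1 = Set.Ico 0 1 := by
        ext q
        simp [Set.uIoc_of_le]
      rw [this, Set.uIoc_of_le zero_le_one]
      exact Ico_ae_eq_Ioc
    rw [Measure.restrict_congr_set hset] at hmp
    exact hf.comp_measurePreserving hmp
  · rw [← sin_pi_mul_one_sub]
    exact ha _ (one_sub_mem_Ioo hq)

/-! ### Fourier modes and the regularised cosine and sine series -/

/-- The Fourier mode `cos(2πjq)`. -/
def cosMode (j : ℤ) (q : ℝ) : ℝ := Real.cos (2 * Real.pi * j * q)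

/-- The Fourier mode `sin(2πjq)`. -/
def sinMode (j : ℤ) (q : ℝ) : ℝ := Real.sin (2 * Real.pi * j * q)

theorem continuous_cosMode (j : ℤ) : Continuous (cosMode j) := by unfold cosMode; fun_prop

theorem continuous_sinMode (j : ℤ) : Continuous (sinMode j) := by unfold sinMode; fun_prop

theorem abs_cosMode_le (j : ℤ) (q : ℝ) : |cosMode j q| ≤ 1 := Real.abs_cos_le_one _

theorem abs_sinMode_le (j : ℤ) (q : ℝ) : |sinMode j q| ≤ 1 := Real.abs_sin_le_one _

theorem cosMode_mul_cosMode (i j : ℤ) (q : ℝ) :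
    cosMode i q * cosMode j q = (cosMode (i + j) q + cosMode (i - j) q) / 2 := by
  simp only [cosMode]
  push_cast
  rw [show 2 * Real.pi * (i + j) * q = 2 * Real.pi * i * q + 2 * Real.pi * j * q by ring,
    show 2 * Real.pi * (i - j) * q = 2 * Real.pi * i * q - 2 * Real.pi * j * q by ring,
    Real.cos_add, Real.cos_sub]
  ring

theorem sinMode_mul_sinMode (i j : ℤ) (q : ℝ) :
    sinMode i q * sinMode j q = (cosMode (i - j) q - cosMode (i + j) q) / 2 := by
  simp only [cosMode, sinMode]
  push_cast
  rw [show 2 * Real.pi * (i + j) * q = 2 * Real.pi * i * q + 2 * Real.pi * j * q by ring,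
    show 2 * Real.pi * (i - j) * q = 2 * Real.pi * i * q - 2 * Real.pi * j * q by ring,
    Real.cos_add, Real.cos_sub]
  ring

theorem cosMode_one_sub (j : ℤ) (q : ℝ) : cosMode j (1 - q) = cosMode j q := by
  rw [cosMode, show 2 * Real.pi * j * (1 - q) = j * (2 * Real.pi) - 2 * Real.pi * j * q by ring,
    Real.cos_int_mul_two_pi_sub, cosMode]

theorem sinMode_one_sub (j : ℤ) (q : ℝ) : sinMode j (1 - q) = -sinMode j q := by
  rw [sinMode, show 2 * Real.pi * j * (1 - q) = j * (2 * Real.pi) - 2 * Real.pi * j * q by ring,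
    Real.sin_int_mul_two_pi_sub, sinMode]

theorem integral_cosMode (j : ℤ) : ∫ q in (0 : ℝ)..1, cosMode j q = if j = 0 then 1 else 0 := by
  split_ifs with h
  · simp [cosMode, h]
  · have hc : 2 * Real.pi * j ≠ 0 :=
      mul_ne_zero (by positivity) (by exact_mod_cast h)
    simp only [cosMode]
    rw [intervalIntegral.integral_comp_mul_left (fun x => Real.cos x) hc, integral_cos]
    have : Real.sin (2 * Real.pi * j * 1) = 0 := by
      rw [show 2 * Real.pi * (j : ℝ) * 1 = ((2 * j : ℤ) : ℝ) * Real.pi by push_cast; ring,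
        Real.sin_int_mul_pi]
    rw [this]
    simp

theorem character_eq_modes (q : ℝ) (n : ℕ) :
    character q n = (cosMode (n + 1) q : ℂ) + (sinMode (n + 1) q : ℂ) * I := by
  rw [character, show 2 * Real.pi * I * q * ((n + 1 : ℕ) : ℂ) =
    ((2 * Real.pi * ((n + 1 : ℤ) : ℝ) * q : ℝ) : ℂ) * I by push_cast; ring, exp_mul_I,
    ← ofReal_cos, ← ofReal_sin]
  rfl

/-- The regularised series `∑ ρ^n cos(2πnq) / n^k`. -/
def abelCos (k : ℕ) (ρ q : ℝ) : ℝ := ∑' n : ℕ, cosMode (n + 1) q * abelWeight k ρ n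

/-- The regularised series `∑ ρ^n sin(2πnq) / n^k`. -/
def abelSin (k : ℕ) (ρ q : ℝ) : ℝ := ∑' n : ℕ, sinMode (n + 1) q * abelWeight k ρ n

theorem norm_cosMode_mul_abelWeight_le (k : ℕ) {ρ : ℝ} (hρ : 0 ≤ ρ) (j : ℤ) (q : ℝ) (n : ℕ) :
    ‖cosMode j q * abelWeight k ρ n‖ ≤ abelWeight k ρ n := by
  rw [norm_mul, Real.norm_eq_abs, Real.norm_eq_abs, abs_of_nonneg (abelWeight_nonneg hρ n)]
  exact mul_le_of_le_one_left (abelWeight_nonneg hρ n) (abs_cosMode_le j q)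

theorem norm_sinMode_mul_abelWeight_le (k : ℕ) {ρ : ℝ} (hρ : 0 ≤ ρ) (j : ℤ) (q : ℝ) (n : ℕ) :
    ‖sinMode j q * abelWeight k ρ n‖ ≤ abelWeight k ρ n := by
  rw [norm_mul, Real.norm_eq_abs, Real.norm_eq_abs, abs_of_nonneg (abelWeight_nonneg hρ n)]
  exact mul_le_of_le_one_left (abelWeight_nonneg hρ n) (abs_sinMode_le j q)

theorem summable_norm_abelCos (k : ℕ) {ρ : ℝ} (hρ : ρ ∈ Set.Ico (0 : ℝ) 1) (q : ℝ) :
    Summable fun n : ℕ => ‖cosMode (n + 1) q * abelWeight k ρ n‖ :=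
  .of_nonneg_of_le (fun _ => norm_nonneg _)
    (fun n => norm_cosMode_mul_abelWeight_le k hρ.1 (n + 1) q n) (summable_abelWeight k hρ)

theorem summable_norm_abelSin (k : ℕ) {ρ : ℝ} (hρ : ρ ∈ Set.Ico (0 : ℝ) 1) (q : ℝ) :
    Summable fun n : ℕ => ‖sinMode (n + 1) q * abelWeight k ρ n‖ :=
  .of_nonneg_of_le (fun _ => norm_nonneg _)
    (fun n => norm_sinMode_mul_abelWeight_le k hρ.1 (n + 1) q n) (summable_abelWeight k hρ)

theorem continuous_abelCos (k : ℕ) {ρ : ℝ} (hρ : ρ ∈ Set.Ico (0 : ℝ) 1) :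
    Continuous (abelCos k ρ) :=
  continuous_tsum (fun _ => (continuous_cosMode _).mul continuous_const) (summable_abelWeight k hρ)
    fun n q => norm_cosMode_mul_abelWeight_le k hρ.1 (n + 1) q n

theorem continuous_abelSin (k : ℕ) {ρ : ℝ} (hρ : ρ ∈ Set.Ico (0 : ℝ) 1) :
    Continuous (abelSin k ρ) :=
  continuous_tsum (fun _ => (continuous_sinMode _).mul continuous_const) (summable_abelWeight k hρ)
    fun n q => norm_sinMode_mul_abelWeight_le k hρ.1 (n + 1) q n

theorem abelExp_eq (k : ℕ) {ρ : ℝ} (hρ : ρ ∈ Set.Ico (0 : ℝ) 1) (q : ℝ) :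
    abelExp k ρ q = (abelCos k ρ q : ℂ) + (abelSin k ρ q : ℂ) * I := by
  have hc := (summable_norm_abelCos k hρ q).of_norm.hasSum
  have hs := (summable_norm_abelSin k hρ q).of_norm.hasSum
  have h := (hasSum_ofReal.2 hc).add ((hasSum_ofReal.2 hs).mul_right I)
  refine Eq.trans ?_ h.tsum_eq
  refine tsum_congr fun n => ?_
  rw [character_eq_modes]
  push_cast
  ring

theorem abelCos_one_sub (k : ℕ) (ρ q : ℝ) : abelCos k ρ (1 - q) = abelCos k ρ q := by
  simp only [abelCos, cosMode_one_sub]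

theorem abelSin_one_sub (k : ℕ) (ρ q : ℝ) : abelSin k ρ (1 - q) = -abelSin k ρ q := by
  simp only [abelSin, sinMode_one_sub, neg_mul, tsum_neg]

theorem tendsto_abelCos {q : ℝ} (hq : q ∈ Set.Ioo (0 : ℝ) 1) {k : ℕ} (hk : 1 ≤ k) :
    Tendsto (fun ρ => (abelCos k ρ q : ℂ)) (𝓝[<] 1) (𝓝 (cosZeta q k)) := by
  have h := ((tendsto_abelExp hq hk).add (tendsto_abelExp (one_sub_mem_Ioo hq) hk)).div_const 2
  rw [cosZeta_eq, ← coe_one_sub]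
  refine h.congr' ?_
  filter_upwards [Ico_mem_nhdsWithin_one] with ρ hρ
  rw [abelExp_eq k hρ, abelExp_eq k hρ, abelCos_one_sub, abelSin_one_sub]
  push_cast
  ring

theorem tendsto_abelSin {q : ℝ} (hq : q ∈ Set.Ioo (0 : ℝ) 1) {k : ℕ} (hk : 1 ≤ k) :
    Tendsto (fun ρ => (abelSin k ρ q : ℂ)) (𝓝[<] 1) (𝓝 (sinZeta q k)) := by
  have h := ((tendsto_abelExp hq hk).sub
    (tendsto_abelExp (one_sub_mem_Ioo hq) hk)).div_const (2 * I)
  rw [sinZeta_eq, ← coe_one_sub]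
  refine h.congr' ?_
  filter_upwards [Ico_mem_nhdsWithin_one] with ρ hρ
  rw [abelExp_eq k hρ, abelExp_eq k hρ, abelCos_one_sub, abelSin_one_sub]
  push_cast
  field_simp
  ring

theorem exists_norm_abelCos_abelSin_le : ∃ c : ℝ, 0 ≤ c ∧ ∀ k : ℕ, 1 ≤ k →
    ∀ ρ ∈ Set.Ico (0 : ℝ) 1, ∀ q ∈ Set.Ioo (0 : ℝ) 1,
      ‖(abelCos k ρ q : ℂ)‖ ≤ c * Real.sin (Real.pi * q) ^ (-(1 / 4) : ℝ) ∧
      ‖(abelSin k ρ q : ℂ)‖ ≤ c * Real.sin (Real.pi * q) ^ (-(1 / 4) : ℝ) := by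
  obtain ⟨c, hc0, hc⟩ := exists_norm_abelExp_le
  refine ⟨c, hc0, fun k hk ρ hρ q hq => ?_⟩
  have h := hc k hk ρ hρ q hq
  rw [abelExp_eq k hρ] at h
  have hre := (abs_re_le_norm _).trans h
  have him := (abs_im_le_norm _).trans h
  simp only [add_re, ofReal_re, mul_re, I_re, mul_zero, ofReal_im, I_im, zero_mul, sub_zero,
    add_zero] at hre
  simp only [add_im, ofReal_im, mul_im, ofReal_re, I_im, mul_one, I_re, mul_zero, add_zero,
    zero_add] at him
  exact ⟨by rwa [norm_real], by rwa [norm_real]⟩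

/-! ### Fourier coefficients of log sin πq -/

theorem integral_cosMode_mul_cosMode {j : ℕ} (hj : 1 ≤ j) (n : ℕ) :
    ∫ q in (0 : ℝ)..1, cosMode j q * cosMode (n + 1) q = if n + 1 = j then 1 / 2 else 0 := by
  simp_rw [cosMode_mul_cosMode]
  rw [intervalIntegral.integral_div, intervalIntegral.integral_add
    ((continuous_cosMode _).intervalIntegrable _ _) ((continuous_cosMode _).intervalIntegrable _ _),
    integral_cosMode, integral_cosMode, if_neg (by omega)]
  by_cases h : n + 1 = j
  · rw [if_pos (by omega), if_pos h]; norm_num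
  · rw [if_neg (by omega), if_neg h]; norm_num

/-- For ρ < 1 the series may be integrated term by term, and orthogonality keeps only the mode j,
which has index j - 1. -/
theorem integral_cosMode_mul_abelCos_one {j : ℕ} (hj : 1 ≤ j) {ρ : ℝ}
    (hρ : ρ ∈ Set.Ico (0 : ℝ) 1) :
    ∫ q in (0 : ℝ)..1, cosMode j q * abelCos 1 ρ q = ρ ^ j / (2 * j) := by
  have h := intervalIntegral.hasSum_integral_of_dominated_convergence (μ := volume)
    (a := 0) (b := 1) (F := fun (n : ℕ) q => cosMode j q * (cosMode (n + 1) q * abelWeight 1 ρ n))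
    (f := fun q => cosMode j q * abelCos 1 ρ q) (fun n _ => abelWeight 1 ρ n)
    (fun n => ((continuous_cosMode _).mul
      ((continuous_cosMode _).mul continuous_const)).aestronglyMeasurable)
    (fun n => .of_forall fun q _ => ?_) (.of_forall fun q _ => summable_abelWeight 1 hρ)
    (by simp) (.of_forall fun q _ => ?_)
  · rw [← h.tsum_eq, tsum_eq_single (j - 1)]
    · have e : j - 1 + 1 = j := by omega
      simp_rw [← mul_assoc]
      rw [intervalIntegral.integral_mul_const, integral_cosMode_mul_cosMode hj, if_pos e,
        abelWeight, e]
      ring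
    · intro n hn
      simp_rw [← mul_assoc]
      rw [intervalIntegral.integral_mul_const, integral_cosMode_mul_cosMode hj,
        if_neg (by omega), zero_mul]
  · rw [norm_mul]
    exact (mul_le_of_le_one_left (norm_nonneg _) (abs_cosMode_le _ _)).trans
      (norm_cosMode_mul_abelWeight_le 1 hρ.1 (n + 1) q n)
  · exact (summable_norm_abelCos 1 hρ q).of_norm.hasSum.mul_left _

theorem intervalIntegrable_cosMode_mul_K (j : ℤ) :
    IntervalIntegrable (fun q => (cosMode j q : ℂ) * K q) volume 0 1 := by
  have h1 : Mild fun _ => 1 := mild_of_continuous continuous_const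
  have h2 : Mild fun q => (cosMode j q : ℂ) :=
    mild_of_continuous (continuous_ofReal.comp (continuous_cosMode j))
  simpa using! h1.converges h2

/-- The Fourier coefficients of `log sin πq`. -/
theorem integral_cosMode_mul_K {j : ℕ} (hj : 1 ≤ j) :
    ∫ q in (0 : ℝ)..1, (cosMode j q : ℂ) * K q = -(1 / (2 * j)) := by
  obtain ⟨c, hc0, hc⟩ := exists_norm_abelCos_abelSin_le
  have lim : Tendsto (fun ρ => ∫ q in (0 : ℝ)..1, (cosMode j q : ℂ) * (abelCos 1 ρ q : ℂ)) (𝓝[<] 1)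
      (𝓝 (∫ q in (0 : ℝ)..1, (cosMode j q : ℂ) * cosZeta q 1)) := by
    refine intervalIntegral.tendsto_integral_filter_of_dominated_convergence
      (fun q => c * Real.sin (Real.pi * q) ^ (-(1 / 4) : ℝ)) ?_ ?_ ?_ ?_
    · filter_upwards [Ico_mem_nhdsWithin_one] with ρ hρ
      exact ((continuous_ofReal.comp (continuous_cosMode _)).mul
        (continuous_ofReal.comp (continuous_abelCos 1 hρ))).aestronglyMeasurable
    · filter_upwards [Ico_mem_nhdsWithin_one] with ρ hρ
      filter_upwards [ae_mem_uIoc_imp_mem_Ioo] with q hq hq'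
      rw [norm_mul]
      refine (mul_le_of_le_one_left (norm_nonneg _) ?_).trans (hc 1 le_rfl ρ hρ q (hq hq')).1
      rw [norm_real]
      exact abs_cosMode_le _ _
    · exact (intervalIntegrable_sin_rpow (by norm_num) (by norm_num)).const_mul c
    · filter_upwards [ae_mem_uIoc_imp_mem_Ioo] with q hq hq'
      have := tendsto_abelCos (hq hq') (le_refl 1)
      rw [Nat.cast_one] at this
      exact this.const_mul _
  have lim' : Tendsto (fun ρ : ℝ => ((ρ ^ j / (2 * j) : ℝ) : ℂ)) (𝓝[<] 1)
      (𝓝 (((1 : ℝ) ^ j / (2 * j) : ℝ) : ℂ)) := by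
    have : Continuous fun ρ : ℝ => ((ρ ^ j / (2 * j) : ℝ) : ℂ) := by fun_prop
    exact (this.tendsto 1).mono_left nhdsWithin_le_nhds
  have e := tendsto_nhds_unique lim (lim'.congr' (by
    filter_upwards [Ico_mem_nhdsWithin_one] with ρ hρ
    rw [← integral_cosMode_mul_abelCos_one hj hρ, ← intervalIntegral.integral_ofReal]
    simp))
  -- At index 1 the cosine series is -log 2 - K; the constant drops out against a mode with j ≥ 1.
  have e2 : ∫ q in (0 : ℝ)..1, (cosMode j q : ℂ) * cosZeta q 1 =
      ∫ q in (0 : ℝ)..1, (-(Real.log 2 : ℂ) * (cosMode j q : ℂ) - (cosMode j q : ℂ) * K q) := by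
    refine intervalIntegral.integral_congr_ae ?_
    filter_upwards [ae_mem_uIoc_imp_mem_Ioo] with q hq hq'
    rw [cosZeta_one (hq hq')]
    ring
  have hcont : Continuous fun q => -(Real.log 2 : ℂ) * (cosMode j q : ℂ) :=
    continuous_const.mul (continuous_ofReal.comp (continuous_cosMode _))
  rw [e2, intervalIntegral.integral_sub (hcont.intervalIntegrable _ _)
    (intervalIntegrable_cosMode_mul_K _), intervalIntegral.integral_const_mul,
    intervalIntegral.integral_ofReal, integral_cosMode, if_neg (by omega)] at e
  push_cast at e
  simp only [mul_zero, zero_sub, one_pow] at e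
  linear_combination -e

/-- The factor j cancels the decay 1/|j| and leaves a sign. It also makes j = 0 trivial, so the mean
of log sin πq is never needed. -/
theorem int_mul_integral_cosMode_mul_K (j : ℤ) :
    (j : ℂ) * ∫ q in (0 : ℝ)..1, (cosMode j q : ℂ) * K q = -((j.sign : ℤ) : ℂ) / 2 := by
  have hnat : ∀ n : ℕ, 1 ≤ n →
      (n : ℂ) * ∫ q in (0 : ℝ)..1, (cosMode n q : ℂ) * K q = -1 / 2 := by
    intro n hn
    have : (n : ℂ) ≠ 0 := by exact_mod_cast (by omega : n ≠ 0)
    rw [integral_cosMode_mul_K hn]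
    field_simp
  rcases lt_trichotomy j 0 with h | rfl | h
  · have hneg : ∀ q, cosMode j q = cosMode (j.natAbs : ℤ) q := by
      intro q
      have e : (j : ℤ) = -(j.natAbs : ℤ) := by omega
      rw [cosMode, cosMode]
      conv_lhs => rw [e]
      rw [← Real.cos_neg]
      congr 1
      push_cast
      ring
    have hj : (j : ℂ) = -((j.natAbs : ℕ) : ℂ) := by
      have e : (j : ℤ) = -(j.natAbs : ℤ) := by omega
      simpa only [Int.cast_neg, Int.cast_natCast] using congrArg (Int.cast : ℤ → ℂ) e
    simp_rw [hneg]
    rw [hj, neg_mul, hnat _ (by omega), Int.sign_eq_neg_one_of_neg h]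
    push_cast
    ring
  · simp
  · obtain ⟨n, rfl⟩ := Int.eq_ofNat_of_zero_le h.le
    have := hnat n (by omega)
    rw [Int.sign_eq_one_of_pos h]
    push_cast
    exact this

/-! ### The double series integrated against log sin πq -/

theorem abelWeight_eq_mul_succ (k : ℕ) (ρ : ℝ) (n : ℕ) :
    abelWeight k ρ n = (n + 1) * abelWeight (k + 1) ρ n := by
  have : ((n : ℝ) + 1) ≠ 0 := by positivity
  unfold abelWeight
  push_cast
  rw [pow_succ ((n : ℝ) + 1) k]
  field_simp

theorem summable_abelWeight_mul (a b : ℕ) {ρ : ℝ} (hρ : ρ ∈ Set.Ico (0 : ℝ) 1) :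
    Summable fun p : ℕ × ℕ => abelWeight a ρ p.1 * abelWeight b ρ p.2 :=
  (summable_abelWeight a hρ).mul_of_nonneg (summable_abelWeight b hρ)
    (fun n => abelWeight_nonneg hρ.1 n) fun n => abelWeight_nonneg hρ.1 n

/-- The term at `(r,s)` of the double series
`∑ ρ^{r+s} r^{-a-1} s^{-b-1} (r cos(2πrq) cos(2πsq) - s sin(2πrq) sin(2πsq))`. -/
def abelTerm (a b : ℕ) (ρ q : ℝ) (p : ℕ × ℕ) : ℝ :=
  (cosMode (p.1 + 1) q * abelWeight a ρ p.1) * (cosMode (p.2 + 1) q * abelWeight (b + 1) ρ p.2) -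
    (sinMode (p.1 + 1) q * abelWeight (a + 1) ρ p.1) * (sinMode (p.2 + 1) q * abelWeight b ρ p.2)

theorem continuous_abelTerm (a b : ℕ) (ρ : ℝ) (p : ℕ × ℕ) :
    Continuous fun q => abelTerm a b ρ q p := by
  have := continuous_cosMode
  have := continuous_sinMode
  unfold abelTerm
  fun_prop

theorem hasSum_abelTerm (a b : ℕ) {ρ : ℝ} (hρ : ρ ∈ Set.Ico (0 : ℝ) 1) (q : ℝ) :
    HasSum (abelTerm a b ρ q) (abelCos a ρ q * abelCos (b + 1) ρ q -
      abelSin (a + 1) ρ q * abelSin b ρ q) := by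
  have c₁ := summable_norm_abelCos a hρ q
  have c₂ := summable_norm_abelCos (b + 1) hρ q
  have s₁ := summable_norm_abelSin (a + 1) hρ q
  have s₂ := summable_norm_abelSin b hρ q
  have hc := (summable_mul_of_summable_norm c₁ c₂).hasSum
  have hs := (summable_mul_of_summable_norm s₁ s₂).hasSum
  rw [← tsum_mul_tsum_of_summable_norm c₁ c₂] at hc
  rw [← tsum_mul_tsum_of_summable_norm s₁ s₂] at hs
  exact hc.sub hs

/-- Product-to-sum formulas: r cos cos - s sin sin regroups so that each mode is multiplied by its
own frequency, the shape that `int_mul_integral_cosMode_mul_K` requires. -/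
theorem abelTerm_eq (a b : ℕ) (ρ q : ℝ) (p : ℕ × ℕ) :
    abelTerm a b ρ q p = abelWeight (a + 1) ρ p.1 * abelWeight (b + 1) ρ p.2 *
      ((((p.1 + 1) + (p.2 + 1) : ℤ) * cosMode ((p.1 + 1) + (p.2 + 1)) q +
        ((p.1 + 1) - (p.2 + 1) : ℤ) * cosMode ((p.1 + 1) - (p.2 + 1)) q) / 2) := by
  have hc := cosMode_mul_cosMode (p.1 + 1) (p.2 + 1) q
  have hs := sinMode_mul_sinMode (p.1 + 1) (p.2 + 1) q
  rw [abelTerm, abelWeight_eq_mul_succ a, abelWeight_eq_mul_succ b]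
  push_cast
  linear_combination ((p.1 : ℝ) + 1) * abelWeight (a + 1) ρ p.1 * abelWeight (b + 1) ρ p.2 * hc -
    ((p.2 : ℝ) + 1) * abelWeight (a + 1) ρ p.1 * abelWeight (b + 1) ρ p.2 * hs

/-- The integral of the `(r,s)` term against `log sin πq`. -/
def pairTerm (a b : ℕ) (ρ : ℝ) (p : ℕ × ℕ) : ℝ :=
  abelWeight (a + 1) ρ p.1 * abelWeight (b + 1) ρ p.2 *
    (-(1 + (((p.1 : ℤ) - p.2).sign : ℝ)) / 4)

theorem integral_abelTerm_mul_K (a b : ℕ) (ρ : ℝ) (p : ℕ × ℕ) :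
    ∫ q in (0 : ℝ)..1, (abelTerm a b ρ q p : ℂ) * K q = (pairTerm a b ρ p : ℂ) := by
  have h₁ := int_mul_integral_cosMode_mul_K ((p.1 + 1) + (p.2 + 1))
  have h₂ := int_mul_integral_cosMode_mul_K ((p.1 + 1) - (p.2 + 1))
  have i₁ := intervalIntegrable_cosMode_mul_K ((p.1 + 1) + (p.2 + 1))
  have i₂ := intervalIntegrable_cosMode_mul_K ((p.1 + 1) - (p.2 + 1))
  rw [Int.sign_eq_one_of_pos (by omega)] at h₁
  rw [show ((p.1 : ℤ) + 1) - (p.2 + 1) = p.1 - p.2 by ring] at h₂ i₂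
  have e : ∀ q, (abelTerm a b ρ q p : ℂ) * K q =
      (abelWeight (a + 1) ρ p.1 * abelWeight (b + 1) ρ p.2 / 2 : ℂ) *
      (((((p.1 + 1) + (p.2 + 1) : ℤ) : ℂ)) * ((cosMode ((p.1 + 1) + (p.2 + 1)) q : ℂ) * K q) +
        (((p.1 - p.2 : ℤ)) : ℂ) * ((cosMode (p.1 - p.2) q : ℂ) * K q)) := by
    intro q
    rw [abelTerm_eq, show ((p.1 : ℤ) + 1) - (p.2 + 1) = p.1 - p.2 by ring]
    push_cast
    ring
  simp_rw [e]
  rw [intervalIntegral.integral_const_mul, intervalIntegral.integral_add (i₁.const_mul _)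
    (i₂.const_mul _), intervalIntegral.integral_const_mul, intervalIntegral.integral_const_mul,
    h₁, h₂, pairTerm]
  push_cast
  ring

/-- For fixed ρ < 1 the weights decay geometrically, so a summable multiple of |K| dominates and sum
and integral may be exchanged. -/
theorem hasSum_pairTerm (a b : ℕ) {ρ : ℝ} (hρ : ρ ∈ Set.Ico (0 : ℝ) 1) :
    HasSum (fun p => (pairTerm a b ρ p : ℂ))
      (∫ q in (0 : ℝ)..1, ((abelCos a ρ q : ℂ) * (abelCos (b + 1) ρ q : ℂ) -
      (abelSin (a + 1) ρ q : ℂ) * (abelSin b ρ q : ℂ)) * K q) := by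
  simp_rw [← integral_abelTerm_mul_K]
  set w : ℕ × ℕ → ℝ := fun p => abelWeight a ρ p.1 * abelWeight (b + 1) ρ p.2 +
    abelWeight (a + 1) ρ p.1 * abelWeight b ρ p.2 with hw
  have hwsum : Summable w :=
    (summable_abelWeight_mul a (b + 1) hρ).add (summable_abelWeight_mul (a + 1) b hρ)
  refine intervalIntegral.hasSum_integral_of_dominated_convergence (fun p q => w p * ‖K q‖)
    (fun p => ?_) (fun p => .of_forall fun q _ => ?_) (.of_forall fun q _ => hwsum.mul_right _)
    ?_ (.of_forall fun q _ => ?_)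
  · exact ((continuous_ofReal.comp (continuous_abelTerm a b ρ p)).measurable.mul
      measurable_K).aestronglyMeasurable
  · rw [norm_mul, norm_real]
    refine mul_le_mul_of_nonneg_right ((norm_sub_le _ _).trans ?_) (norm_nonneg _)
    rw [norm_mul, norm_mul (sinMode _ _ * _)]
    exact add_le_add
      (mul_le_mul (norm_cosMode_mul_abelWeight_le _ hρ.1 _ _ _)
        (norm_cosMode_mul_abelWeight_le _ hρ.1 _ _ _) (norm_nonneg _) (abelWeight_nonneg hρ.1 _))
      (mul_le_mul (norm_sinMode_mul_abelWeight_le _ hρ.1 _ _ _)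
        (norm_sinMode_mul_abelWeight_le _ hρ.1 _ _ _) (norm_nonneg _) (abelWeight_nonneg hρ.1 _))
  · simp_rw [tsum_mul_right]
    have h := (intervalIntegrable_cosMode_mul_K 0).norm
    simp only [cosMode, Int.cast_zero, mul_zero, zero_mul, Real.cos_zero, ofReal_one,
      one_mul] at h
    exact h.const_mul _
  · have h := hasSum_ofReal.2 (hasSum_abelTerm a b hρ q)
    push_cast at h
    exact h.mul_right _

theorem summable_abelWeight_one {k : ℕ} (hk : 2 ≤ k) : Summable (abelWeight k 1) := by
  have h := (summable_nat_add_iff 1).2 (Real.summable_one_div_nat_pow.2 (by omega : 1 < k))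
  refine h.congr fun n => ?_
  simp [abelWeight]

theorem abelWeight_le_abelWeight_one (k : ℕ) {ρ : ℝ} (hρ : ρ ∈ Set.Ico (0 : ℝ) 1) (n : ℕ) :
    abelWeight k ρ n ≤ abelWeight k 1 n := by
  unfold abelWeight
  gcongr
  · exact hρ.1
  · exact hρ.2.le

theorem summable_abelWeight_one_mul {a b : ℕ} (ha : 1 ≤ a) (hb : 1 ≤ b) :
    Summable fun p : ℕ × ℕ => abelWeight (a + 1) 1 p.1 * abelWeight (b + 1) 1 p.2 :=
  (summable_abelWeight_one (by omega)).mul_of_nonneg (summable_abelWeight_one (by omega))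
    (fun n => abelWeight_nonneg zero_le_one n) fun n => abelWeight_nonneg zero_le_one n

/-- Dominates the integrated terms as ρ → 1. After integration both exponents have risen to a + 1
and b + 1, so the bound is summable even for a = 1 or b = 1. -/
theorem norm_pairTerm_le (a b : ℕ) {ρ : ℝ} (hρ : ρ ∈ Set.Ico (0 : ℝ) 1) (p : ℕ × ℕ) :
    ‖(pairTerm a b ρ p : ℂ)‖ ≤ abelWeight (a + 1) 1 p.1 * abelWeight (b + 1) 1 p.2 := by
  have h₁ := abelWeight_nonneg (k := a + 1) hρ.1 p.1
  have h₂ := abelWeight_nonneg (k := b + 1) hρ.1 p.2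
  have hs : |-(1 + (((p.1 : ℤ) - p.2).sign : ℝ)) / 4| ≤ 1 := by
    rcases Int.sign_trichotomy ((p.1 : ℤ) - p.2) with h | h | h <;> rw [h] <;> norm_num
  rw [norm_real, Real.norm_eq_abs, pairTerm, abs_mul, abs_of_nonneg (mul_nonneg h₁ h₂)]
  calc _ ≤ abelWeight (a + 1) ρ p.1 * abelWeight (b + 1) ρ p.2 :=
        mul_le_of_le_one_right (mul_nonneg h₁ h₂) hs
    _ ≤ _ := mul_le_mul (abelWeight_le_abelWeight_one _ hρ _) (abelWeight_le_abelWeight_one _ hρ _)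
        h₂ (abelWeight_nonneg zero_le_one _)

/-- The integral of a product of periodic zeta functions against `log sin πq` as a double
series. -/
theorem integral_zeta_mul_K {a b : ℕ} (ha : 1 ≤ a) (hb : 1 ≤ b) :
    ∫ q in (0 : ℝ)..1, (cosZeta q a * cosZeta q (b + 1 : ℕ) -
      sinZeta q (a + 1 : ℕ) * sinZeta q b) * K q = ((∑' p, pairTerm a b 1 p : ℝ) : ℂ) := by
  obtain ⟨c, hc0, hc⟩ := exists_norm_abelCos_abelSin_le
  have lim₁ : Tendsto (fun ρ => ∫ q in (0 : ℝ)..1,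
      ((abelCos a ρ q : ℂ) * (abelCos (b + 1) ρ q : ℂ) -
        (abelSin (a + 1) ρ q : ℂ) * (abelSin b ρ q : ℂ)) * K q) (𝓝[<] 1)
      (𝓝 (∫ q in (0 : ℝ)..1, (cosZeta q a * cosZeta q (b + 1 : ℕ) -
        sinZeta q (a + 1 : ℕ) * sinZeta q b) * K q)) := by
    refine intervalIntegral.tendsto_integral_filter_of_dominated_convergence
      (fun q => 2 * (c * c) * majorant q) ?_ ?_ (intervalIntegrable_majorant.const_mul _) ?_
    · filter_upwards [Ico_mem_nhdsWithin_one] with ρ hρ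
      have h₁ := continuous_ofReal.comp (continuous_abelCos a hρ)
      have h₂ := continuous_ofReal.comp (continuous_abelCos (b + 1) hρ)
      have h₃ := continuous_ofReal.comp (continuous_abelSin (a + 1) hρ)
      have h₄ := continuous_ofReal.comp (continuous_abelSin b hρ)
      exact (((h₁.mul h₂).sub (h₃.mul h₄)).measurable.mul measurable_K).aestronglyMeasurable
    · filter_upwards [Ico_mem_nhdsWithin_one] with ρ hρ
      filter_upwards [ae_mem_uIoc_imp_mem_Ioo] with q hq hq'
      have hq := hq hq'
      rw [sub_mul]
      refine (norm_sub_le _ _).trans ?_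
      have e₁ := norm_mul_mul_K_le (hc a ha ρ hρ q hq).1 (hc (b + 1) (by omega) ρ hρ q hq).1
      have e₂ := norm_mul_mul_K_le (hc (a + 1) (by omega) ρ hρ q hq).2 (hc b hb ρ hρ q hq).2
      linarith
    · filter_upwards [ae_mem_uIoc_imp_mem_Ioo] with q hq hq'
      have hq := hq hq'
      exact (((tendsto_abelCos hq ha).mul (tendsto_abelCos hq (by omega))).sub
        ((tendsto_abelSin hq (by omega)).mul (tendsto_abelSin hq hb))).mul_const _
  have lim₂ : Tendsto (fun ρ => ∑' p, (pairTerm a b ρ p : ℂ)) (𝓝[<] 1)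
      (𝓝 (∑' p, (pairTerm a b 1 p : ℂ))) := by
    refine tendsto_tsum_of_dominated_convergence (summable_abelWeight_one_mul ha hb)
      (fun p => ?_) ?_
    · exact (continuous_ofReal.tendsto _).comp
        (((tendsto_abelWeight _ _).mul (tendsto_abelWeight _ _)).mul_const _)
    · filter_upwards [Ico_mem_nhdsWithin_one] with ρ hρ p
      exact norm_pairTerm_le a b hρ p
  rw [ofReal_tsum]
  refine tendsto_nhds_unique lim₁ (lim₂.congr' ?_)
  filter_upwards [Ico_mem_nhdsWithin_one] with ρ hρ
  exact (hasSum_pairTerm a b hρ).tsum_eq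

/-! ### The Tornheim sum as the part r < s of a product series -/

theorem riemannZeta_eq_tsum_abelWeight {k : ℕ} (hk : 2 ≤ k) :
    riemannZeta k = ((∑' n, abelWeight k 1 n : ℝ) : ℂ) := by
  rw [zeta_nat_eq_tsum_of_gt_one (by omega), ofReal_tsum]
  have hs : Summable fun n : ℕ => 1 / (n : ℂ) ^ k := by
    have := Complex.summable_one_div_nat_cpow (p := k)
    simp only [cpow_natCast, natCast_re] at this
    exact this.2 (by exact_mod_cast (by omega : 1 < k))
  rw [hs.tsum_eq_zero_add]
  simp [abelWeight, show k ≠ 0 by omega]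

theorem term_eq_abelWeight_mul (m n : ℕ) (p : ℕ × ℕ) :
    term m 0 n p = abelWeight m 1 p.1 * abelWeight n 1 (p.1 + p.2 + 1) := by
  rw [term, abelWeight, abelWeight]
  push_cast
  rw [one_pow, one_pow, pow_zero, mul_one, one_div_mul_one_div]
  congr 3
  ring

/-- The map (r,s) ↦ (r, r+s) in indices shifted by one, which explains the extra 1. -/
theorem injective_shear : Function.Injective fun p : ℕ × ℕ => (p.1, p.1 + p.2 + 1) := by
  rintro ⟨a, b⟩ ⟨c, d⟩ h
  simp only [Prod.mk.injEq] at h ⊢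
  omega

theorem summable_term {m n : ℕ} (hm : 2 ≤ m) (hn : 2 ≤ n) : Summable (term m 0 n) := by
  obtain ⟨a, rfl⟩ : ∃ a, m = a + 1 := ⟨m - 1, by omega⟩
  obtain ⟨b, rfl⟩ : ∃ b, n = b + 1 := ⟨n - 1, by omega⟩
  refine ((summable_abelWeight_one_mul (a := a) (b := b) (by omega)
    (by omega)).comp_injective injective_shear).congr fun p => ?_
  rw [term_eq_abelWeight_mul]
  rfl

theorem T_eq_tsum {m n : ℕ} (hm : 2 ≤ m) (hn : 2 ≤ n) :
    T m 0 n = ∑' p : ℕ × ℕ, if p.1 < p.2 then abelWeight m 1 p.1 * abelWeight n 1 p.2 else 0 := by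
  rw [T, ← (summable_term hm hn).tsum_prod, ← injective_shear.tsum_eq (f := fun p : ℕ × ℕ =>
    if p.1 < p.2 then abelWeight m 1 p.1 * abelWeight n 1 p.2 else 0)]
  · refine tsum_congr fun p => ?_
    rw [term_eq_abelWeight_mul, if_pos (show p.1 < p.1 + p.2 + 1 by omega)]
  · rintro ⟨r, s⟩ h
    have hlt : r < s := by
      by_contra hc
      simp [hc] at h
    exact ⟨(r, s - r - 1), by simp; omega⟩

theorem tsum_diagonal (m n : ℕ) :
    ∑' p : ℕ × ℕ, (if p.1 = p.2 then abelWeight m 1 p.1 * abelWeight n 1 p.2 else 0) =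
      ∑' r, abelWeight (m + n) 1 r := by
  have hinj : Function.Injective fun r : ℕ => (r, r) := fun a b h => (Prod.mk.inj h).1
  rw [← hinj.tsum_eq]
  · refine tsum_congr fun r => ?_
    rw [if_pos rfl]
    simp [abelWeight, pow_add, mul_comm]
  · rintro ⟨r, s⟩ h
    have hrs : r = s := by
      by_contra hc
      simp [hc] at h
    exact ⟨r, by simp [hrs]⟩

/-- Pointwise, -(1 + sgn(r-s))/2 = [r < s] + ½[r = s] - 1. -/
theorem two_mul_tsum_pairTerm {a b : ℕ} (ha : 1 ≤ a) (hb : 1 ≤ b) :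
    2 * ∑' p, pairTerm a b 1 p = T (a + 1) 0 (b + 1) +
      1 / 2 * ∑' r, abelWeight ((a + 1) + (b + 1)) 1 r -
      (∑' r, abelWeight (a + 1) 1 r) * ∑' s, abelWeight (b + 1) 1 s := by
  have hs := summable_abelWeight_one_mul ha hb
  have hnn : ∀ p : ℕ × ℕ, 0 ≤ abelWeight (a + 1) 1 p.1 * abelWeight (b + 1) 1 p.2 := fun p =>
    mul_nonneg (abelWeight_nonneg zero_le_one _) (abelWeight_nonneg zero_le_one _)
  have hlt : Summable fun p : ℕ × ℕ =>
      if p.1 < p.2 then abelWeight (a + 1) 1 p.1 * abelWeight (b + 1) 1 p.2 else 0 :=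
    .of_nonneg_of_le (fun p => by split_ifs; exacts [hnn p, le_rfl])
      (fun p => by split_ifs; exacts [le_rfl, hnn p]) hs
  have heq : Summable fun p : ℕ × ℕ =>
      if p.1 = p.2 then abelWeight (a + 1) 1 p.1 * abelWeight (b + 1) 1 p.2 else 0 :=
    .of_nonneg_of_le (fun p => by split_ifs; exacts [hnn p, le_rfl])
      (fun p => by split_ifs; exacts [le_rfl, hnn p]) hs
  have hprod := (summable_abelWeight_one (k := a + 1) (by omega)).tsum_mul_tsum
    (summable_abelWeight_one (k := b + 1) (by omega)) hs
  rw [hprod, ← tsum_diagonal, T_eq_tsum (by omega) (by omega), ← tsum_mul_left, ← tsum_mul_left,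
    ← hlt.tsum_add (heq.mul_left _), ← (hlt.add (heq.mul_left _)).tsum_sub hs]
  refine tsum_congr fun p => ?_
  rw [pairTerm]
  rcases lt_trichotomy p.1 p.2 with h | h | h
  · rw [if_pos h, if_neg h.ne, Int.sign_eq_neg_one_of_neg (by omega)]
    push_cast
    ring
  · rw [if_neg (by omega), if_pos h, show ((p.1 : ℤ) - p.2) = 0 by omega, Int.sign_zero]
    push_cast
    ring
  · rw [if_neg (by omega), if_neg (by omega), Int.sign_eq_one_of_pos (by omega)]
    push_cast
    ring

theorem seven_eighths_lt_re_natCast {k : ℕ} (hk : 1 ≤ k) : 7 / 8 < ((k : ℕ) : ℂ).re := by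
  have : (1 : ℝ) ≤ k := by exact_mod_cast hk
  rw [natCast_re]
  linarith

/-- `∫ cosZeta(q,k) cosZeta(q,l) log sin πq dq`. -/
def cosIntegral (k l : ℕ) : ℂ := ∫ q in (0 : ℝ)..1, cosZeta q k * cosZeta q l * K q

/-- `∫ sinZeta(q,k) sinZeta(q,l) log sin πq dq`. -/
def sinIntegral (k l : ℕ) : ℂ := ∫ q in (0 : ℝ)..1, sinZeta q k * sinZeta q l * K q

theorem T_eq_zeta_add_integrals {m n : ℕ} (hm : 2 ≤ m) (hn : 2 ≤ n) :
    ((T m 0 n : ℝ) : ℂ) = riemannZeta m * riemannZeta n - 1 / 2 * riemannZeta (m + n) +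
      2 * (cosIntegral (m - 1) n - sinIntegral m (n - 1)) := by
  obtain ⟨a, rfl⟩ : ∃ a, m = a + 1 := ⟨m - 1, by omega⟩
  obtain ⟨b, rfl⟩ : ∃ b, n = b + 1 := ⟨n - 1, by omega⟩
  have ha : 1 ≤ a := by omega
  have hb : 1 ≤ b := by omega
  have h := integral_zeta_mul_K ha hb
  simp_rw [sub_mul] at h
  rw [intervalIntegral.integral_sub
    ((mild_cosZeta (seven_eighths_lt_re_natCast ha)).converges (mild_cosZeta (seven_eighths_lt_re_natCast (by omega))))
    ((mild_sinZeta (seven_eighths_lt_re_natCast (by omega))).converges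
      (mild_sinZeta (seven_eighths_lt_re_natCast hb)))] at h
  simp only [Nat.add_sub_cancel]
  rw [cosIntegral, sinIntegral, h, ← Nat.cast_add, riemannZeta_eq_tsum_abelWeight hm,
    riemannZeta_eq_tsum_abelWeight hn, riemannZeta_eq_tsum_abelWeight (by omega)]
  have := congrArg (fun x : ℝ => (x : ℂ)) (two_mul_tsum_pairTerm ha hb)
  push_cast at this ⊢
  linear_combination -this

/-! ### A_k and B_k as Fourier series, by parity -/

/-- At a zero of the factor c the product rule retains only c' H, so no derivative of Gamma or of a
periodic zeta function enters. The minus sign is that of s ↦ 1 - s. -/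
theorem hasDerivAt_of_one_sub_eq_mul {f c H : ℂ → ℂ} {k c' : ℂ}
    (hf : ∀ᶠ s in 𝓝 k, f (1 - s) = c s * H s) (hc : HasDerivAt c c' k) (h0 : c k = 0)
    (hH : DifferentiableAt ℂ H k) : HasDerivAt f (-(c' * H k)) (1 - k) := by
  have h1 : HasDerivAt (fun s => f (1 - s)) (c' * H k) k := by
    have := hc.mul hH.hasDerivAt
    rw [h0, zero_mul, add_zero] at this
    exact this.congr_of_eventuallyEq hf
  have h2 : HasDerivAt (fun z : ℂ => 1 - z) (-1) (1 - k) := (hasDerivAt_id _).const_sub 1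
  rw [← sub_sub_cancel 1 k] at h1
  have h3 := HasDerivAt.comp (1 - k) h1 h2
  simp only [sub_sub_cancel] at h3
  refine (h3.congr_of_eventuallyEq (.of_forall fun z => ?_)).congr_deriv (by ring)
  simp

theorem differentiableAt_two_pi_cpow_mul_Gamma {s : ℂ} (hs : 0 < s.re) :
    DifferentiableAt ℂ (fun s : ℂ => 2 * (2 * Real.pi : ℂ) ^ (-s) * Gamma s) s := by
  have h2pi : (2 * Real.pi : ℂ) ≠ 0 := by exact_mod_cast (by positivity : (2 * Real.pi : ℝ) ≠ 0)
  exact ((differentiableAt_const _).mul (differentiableAt_id.neg.const_cpow (Or.inl h2pi))).mul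
    (differentiableAt_Gamma s (ne_neg_natCast_of_re_pos hs))

theorem eventually_re_pos {s : ℂ} (hs : 0 < s.re) : ∀ᶠ w in 𝓝 s, 0 < w.re :=
  (isOpen_lt continuous_const continuous_re).mem_nhds hs

theorem hasDerivAt_pi_mul_div_two (s : ℂ) :
    HasDerivAt (fun s : ℂ => Real.pi * s / 2) (Real.pi / 2 : ℂ) s := by
  simpa using ((hasDerivAt_id s).const_mul (Real.pi : ℂ)).div_const 2

theorem hasDerivAt_hurwitzZetaEven {q : ℝ} (hq : q ∈ Set.Ioo (0 : ℝ) 1) {s : ℂ} (hs : 0 < s.re)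
    (h0 : cos (Real.pi * s / 2) = 0) :
    HasDerivAt (hurwitzZetaEven q) (Real.pi * sin (Real.pi * s / 2) * (2 * Real.pi : ℂ) ^ (-s) *
      Gamma s * cosZeta q s) (1 - s) := by
  have ha := coe_ne_zero_of_mem_Ioo hq
  refine (hasDerivAt_of_one_sub_eq_mul (c := fun s => cos (Real.pi * s / 2))
    (H := fun s => 2 * (2 * Real.pi : ℂ) ^ (-s) * Gamma s * cosZeta q s) ?_
    (hasDerivAt_pi_mul_div_two s).ccos h0 ?_).congr_deriv (by ring)
  · filter_upwards [eventually_re_pos hs] with w hw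
    rw [hurwitzZetaEven_one_sub _ (ne_neg_natCast_of_re_pos hw) (Or.inl ha)]
    ring
  · exact (differentiableAt_two_pi_cpow_mul_Gamma hs).mul
      (differentiable_cosZeta_of_ne_zero ha s)

theorem hasDerivAt_hurwitzZetaOdd (q : ℝ) {s : ℂ} (hs : 0 < s.re)
    (h0 : sin (Real.pi * s / 2) = 0) :
    HasDerivAt (hurwitzZetaOdd q) (-(Real.pi * cos (Real.pi * s / 2) * (2 * Real.pi : ℂ) ^ (-s) *
      Gamma s * sinZeta q s)) (1 - s) := by
  refine (hasDerivAt_of_one_sub_eq_mul (c := fun s => sin (Real.pi * s / 2))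
    (H := fun s => 2 * (2 * Real.pi : ℂ) ^ (-s) * Gamma s * sinZeta q s) ?_
    (hasDerivAt_pi_mul_div_two s).csin h0 ?_).congr_deriv (by ring)
  · filter_upwards [eventually_re_pos hs] with w hw
    rw [hurwitzZetaOdd_one_sub _ (ne_neg_natCast_of_re_pos hw)]
    ring
  · exact (differentiableAt_two_pi_cpow_mul_Gamma hs).mul (differentiableAt_sinZeta _ s)

/-- The factor `k! / (2π)^k`. -/
def scale (k : ℕ) : ℂ := (k.factorial : ℂ) / (2 * Real.pi : ℂ) ^ k

theorem natCast_mul_cpow_mul_Gamma {k : ℕ} (hk : 1 ≤ k) :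
    (k : ℂ) * ((2 * Real.pi : ℂ) ^ (-(k : ℂ)) * Gamma k) = scale k := by
  obtain ⟨j, rfl⟩ : ∃ j, k = j + 1 := ⟨k - 1, by omega⟩
  rw [cpow_neg, cpow_natCast, scale, Nat.factorial_succ]
  have := Gamma_nat_eq_factorial j
  push_cast
  rw [this]
  ring

theorem cos_natCast_mul_pi (j : ℕ) : cos (j * Real.pi) = (-1) ^ j := by
  rw [show (j : ℂ) * Real.pi = ((j * Real.pi : ℝ) : ℂ) by push_cast; rfl, ← ofReal_cos,
    Real.cos_nat_mul_pi]
  push_cast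
  rfl

/-- The part of `A_k` that is even about `1/2`, for odd `k`. -/
theorem A_add_A_one_sub (j : ℕ) {q : ℝ} (hq : q ∈ Set.Ioo (0 : ℝ) 1) :
    A (2 * j + 1) q + A (2 * j + 1) (1 - q) =
      2 * Real.pi * (-1) ^ j * scale (2 * j + 1) * cosZeta q (2 * j + 1 : ℕ) := by
  set k := 2 * j + 1 with hk
  have hk1 : 1 ≤ k := by omega
  have hre : 0 < ((k : ℕ) : ℂ).re := by linarith [seven_eighths_lt_re_natCast hk1]
  have hang : (Real.pi : ℂ) * (k : ℕ) / 2 = j * Real.pi + Real.pi / 2 := by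
    rw [hk]; push_cast; ring
  have h0 : cos ((Real.pi : ℂ) * (k : ℕ) / 2) = 0 := by
    rw [hang, Complex.cos_add_pi_div_two, Complex.sin_nat_mul_pi, neg_zero]
  have h1 : sin ((Real.pi : ℂ) * (k : ℕ) / 2) = (-1) ^ j := by
    rw [hang, Complex.sin_add_pi_div_two, cos_natCast_mul_pi]
  have hd := (hasDerivAt_hurwitzZetaEven hq hre h0).deriv
  have e : hurwitzZetaEven (q : UnitAddCircle) =
      fun z => (hurwitzZeta q z + hurwitzZeta (-(q : UnitAddCircle)) z) / 2 :=
    funext fun z => hurwitzZetaEven_eq _ _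
  rw [e, deriv_div_const, deriv_fun_add
    (differentiableAt_hurwitzZeta _ (one_sub_natCast_ne_one hk1))
    (differentiableAt_hurwitzZeta _ (one_sub_natCast_ne_one hk1)), h1] at hd
  rw [A_one_sub, A, ← natCast_mul_cpow_mul_Gamma hk1]
  linear_combination 2 * (k : ℂ) * hd

/-- The part of `A_k` that is odd about `1/2`, for even `k`. -/
theorem A_sub_A_one_sub {j : ℕ} (hj : 1 ≤ j) (q : ℝ) :
    A (2 * j) q - A (2 * j) (1 - q) =
      -(2 * Real.pi * (-1) ^ j * scale (2 * j) * sinZeta q (2 * j : ℕ)) := by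
  set k := 2 * j with hk
  have hk1 : 1 ≤ k := by omega
  have hre : 0 < ((k : ℕ) : ℂ).re := by linarith [seven_eighths_lt_re_natCast hk1]
  have hang : (Real.pi : ℂ) * (k : ℕ) / 2 = j * Real.pi := by
    rw [hk]; push_cast; ring
  have h0 : sin ((Real.pi : ℂ) * (k : ℕ) / 2) = 0 := by rw [hang, Complex.sin_nat_mul_pi]
  have h1 : cos ((Real.pi : ℂ) * (k : ℕ) / 2) = (-1) ^ j := by rw [hang, cos_natCast_mul_pi]
  have hd := (hasDerivAt_hurwitzZetaOdd q hre h0).deriv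
  have e : hurwitzZetaOdd (q : UnitAddCircle) =
      fun z => (hurwitzZeta q z - hurwitzZeta (-(q : UnitAddCircle)) z) / 2 :=
    funext fun z => hurwitzZetaOdd_eq _ _
  rw [e, deriv_div_const, deriv_fun_sub
    (differentiableAt_hurwitzZeta _ (one_sub_natCast_ne_one hk1))
    (differentiableAt_hurwitzZeta _ (one_sub_natCast_ne_one hk1)), h1] at hd
  rw [A_one_sub, A, ← natCast_mul_cpow_mul_Gamma hk1]
  linear_combination 2 * (k : ℂ) * hd

theorem eval_bernoulli_map_eq_B (k : ℕ) (q : ℝ) :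
    ((Polynomial.bernoulli k).map (algebraMap ℚ ℂ)).eval (q : ℂ) = B k q := by
  rw [B, bernoulliFun, Polynomial.eval_map_algebraMap, Polynomial.eval_map_algebraMap]
  exact (Polynomial.aeval_algebraMap_apply ℂ q (Polynomial.bernoulli k))

theorem two_pi_ne_zero' : (2 * Real.pi : ℂ) ≠ 0 := by
  exact_mod_cast (by positivity : (2 * Real.pi : ℝ) ≠ 0)

theorem B_even_eq {j : ℕ} (hj : 1 ≤ j) {q : ℝ} (hq : q ∈ Set.Ioo (0 : ℝ) 1) :
    B (2 * j) q = -(2 * (-1) ^ j * scale (2 * j) * cosZeta q (2 * j : ℕ)) := by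
  have h := cosZeta_two_mul_nat (k := j) (by omega) ⟨hq.1.le, hq.2.le⟩
  rw [eval_bernoulli_map_eq_B] at h
  have hf : ((2 * j).factorial : ℂ) ≠ 0 := by exact_mod_cast Nat.factorial_ne_zero _
  have hp := pow_ne_zero (2 * j) two_pi_ne_zero'
  have h1 : ((-1 : ℂ) ^ j) * (-1) ^ j = 1 := by rw [← mul_pow]; norm_num
  rw [scale]
  push_cast
  rw [h, pow_succ]
  field_simp
  linear_combination -B (2 * j) q * h1

theorem B_odd_eq (j : ℕ) {q : ℝ} (hq : q ∈ Set.Ioo (0 : ℝ) 1) :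
    B (2 * j + 1) q = -(2 * (-1) ^ j * scale (2 * j + 1) * sinZeta q (2 * j + 1 : ℕ)) := by
  -- B_1 is the sawtooth, whose series converges only conditionally; it rests on the closed form of
  -- `sinZeta q 1`.
  rcases Nat.eq_zero_or_pos j with rfl | hj
  · have hpi : (Real.pi : ℂ) ≠ 0 := by exact_mod_cast Real.pi_ne_zero
    simp only [mul_zero, zero_add, Nat.cast_one, pow_zero, mul_one, scale, Nat.factorial_one,
      pow_one, sinZeta_one hq, B, bernoulliFun_one]
    push_cast
    field_simp
  · have h := sinZeta_two_mul_nat_add_one (k := j) (by omega) ⟨hq.1.le, hq.2.le⟩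
    rw [eval_bernoulli_map_eq_B] at h
    have hf : ((2 * j + 1).factorial : ℂ) ≠ 0 := by exact_mod_cast Nat.factorial_ne_zero _
    have hp := pow_ne_zero (2 * j + 1) two_pi_ne_zero'
    have h1 : ((-1 : ℂ) ^ j) * (-1) ^ j = 1 := by rw [← mul_pow]; norm_num
    rw [scale]
    push_cast
    rw [h, pow_succ (-1 : ℂ) j]
    field_simp
    linear_combination -B (2 * j + 1) q * h1

/-! ### Symmetry about 1/2 and the basic integrals -/

theorem K_one_sub (q : ℝ) : K (1 - q) = K q := by
  rw [K, K, sin_pi_mul_one_sub]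

/-- Symmetrisation of an integral under `q ↦ 1 - q`. -/
theorem two_mul_integral_eq {f g : ℝ → ℂ} {ε : ℂ} (hf : Mild f) (hg : Mild g)
    (h : ∀ q ∈ Set.Ioo (0 : ℝ) 1, g (1 - q) = ε * g q) :
    2 * ∫ q in (0 : ℝ)..1, f q * g q * K q =
      ∫ q in (0 : ℝ)..1, (f q + ε * f (1 - q)) * g q * K q := by
  have e₁ : ∫ q in (0 : ℝ)..1, f q * g q * K q =
      ∫ q in (0 : ℝ)..1, (ε * f (1 - q)) * g q * K q := by
    have h1 := intervalIntegral.integral_comp_sub_left (a := 0) (b := 1)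
      (fun q => f q * g q * K q) 1
    simp only [sub_self, sub_zero] at h1
    rw [← h1]
    refine intervalIntegral.integral_congr_ae ?_
    filter_upwards [ae_mem_uIoc_imp_mem_Ioo] with q hq hq'
    rw [h q (hq hq'), K_one_sub]
    ring
  have e₂ := intervalIntegral.integral_add (hf.converges hg)
    ((hf.comp_one_sub.const_mul ε).converges hg)
  rw [two_mul]
  nth_rewrite 2 [e₁]
  rw [← e₂]
  simp_rw [add_mul]

theorem B_one_sub (k : ℕ) (q : ℝ) : B k (1 - q) = (-1) ^ k * B k q := by
  rw [B, B, bernoulliFun_eval_one_sub]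
  push_cast
  rfl

/-- Integrals over `(0,1)` of functions that agree there up to a constant factor. -/
theorem integral_eq_const_mul {f g : ℝ → ℂ} {c : ℂ}
    (h : ∀ q ∈ Set.Ioo (0 : ℝ) 1, f q = c * g q) :
    ∫ q in (0 : ℝ)..1, f q = c * ∫ q in (0 : ℝ)..1, g q := by
  rw [← intervalIntegral.integral_const_mul]
  refine intervalIntegral.integral_congr_ae ?_
  filter_upwards [ae_mem_uIoc_imp_mem_Ioo] with q hq hq'
  exact h q (hq hq')

/-- A Bernoulli polynomial of even index is even about 1/2, so only the even part of A contributes,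
and that part is a cosine series. -/
theorem integral_fAB_odd_even (i : ℕ) {j : ℕ} (hj : 1 ≤ j) :
    ∫ q in (0 : ℝ)..1, fAB (2 * i + 1) (2 * j) q =
      -(2 * Real.pi * (-1) ^ (i + j) * scale (2 * i + 1) * scale (2 * j) *
        cosIntegral (2 * i + 1) (2 * j)) := by
  have h := two_mul_integral_eq (ε := 1) (mild_A (k := 2 * i + 1) (by omega)) (mild_B (2 * j))
    fun q _ => by rw [B_one_sub, pow_mul]; norm_num
  rw [integral_eq_const_mul (f := fun q => (A (2 * i + 1) q + 1 * A (2 * i + 1) (1 - q)) *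
      B (2 * j) q * K q) (g := fun q => cosZeta q (2 * i + 1 : ℕ) * cosZeta q (2 * j : ℕ) * K q)
    (c := -(4 * Real.pi * (-1) ^ (i + j) * scale (2 * i + 1) * scale (2 * j)))
    fun q hq => by
      rw [one_mul, A_add_A_one_sub i hq, B_even_eq hj hq, pow_add]
      ring] at h
  rw [cosIntegral]
  simp only [fAB]
  linear_combination h / 2

theorem integral_fAB_even_odd {i : ℕ} (hi : 1 ≤ i) (j : ℕ) :
    ∫ q in (0 : ℝ)..1, fAB (2 * i) (2 * j + 1) q =
      2 * Real.pi * (-1) ^ (i + j) * scale (2 * i) * scale (2 * j + 1) *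
        sinIntegral (2 * i) (2 * j + 1) := by
  have h := two_mul_integral_eq (ε := -1) (mild_A (k := 2 * i) (by omega)) (mild_B (2 * j + 1))
    fun q _ => by rw [B_one_sub, pow_succ, pow_mul]; norm_num
  rw [integral_eq_const_mul (f := fun q => (A (2 * i) q + -1 * A (2 * i) (1 - q)) *
      B (2 * j + 1) q * K q) (g := fun q => sinZeta q (2 * i : ℕ) * sinZeta q (2 * j + 1 : ℕ) * K q)
    (c := 4 * Real.pi * (-1) ^ (i + j) * scale (2 * i) * scale (2 * j + 1))
    fun q hq => by
      rw [neg_one_mul, ← sub_eq_add_neg, A_sub_A_one_sub hi q, B_odd_eq j hq, pow_add]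
      ring] at h
  rw [sinIntegral]
  simp only [fAB]
  linear_combination h / 2

theorem I_BB_even_even {i j : ℕ} (hi : 1 ≤ i) (hj : 1 ≤ j) :
    I_BB (2 * i) (2 * j) =
      4 * (-1) ^ (i + j) * scale (2 * i) * scale (2 * j) * cosIntegral (2 * i) (2 * j) := by
  rw [I_BB, cosIntegral]
  refine integral_eq_const_mul fun q hq => ?_
  rw [fBB, B_even_eq hi hq, B_even_eq hj hq, pow_add]
  ring

theorem I_BB_odd_odd (i j : ℕ) :
    I_BB (2 * i + 1) (2 * j + 1) =
      4 * (-1) ^ (i + j) * scale (2 * i + 1) * scale (2 * j + 1) *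
        sinIntegral (2 * i + 1) (2 * j + 1) := by
  rw [I_BB, sinIntegral]
  refine integral_eq_const_mul fun q hq => ?_
  rw [fBB, B_odd_eq i hq, B_odd_eq j hq, pow_add]
  ring

theorem converges_fAA {k l : ℕ} (hk : 1 ≤ k) (hl : 1 ≤ l) : Converges (fAA k l) :=
  (mild_A hk).converges (mild_A hl)

theorem converges_gAA {k l : ℕ} (hk : 1 ≤ k) (hl : 1 ≤ l) : Converges (gAA k l) :=
  (mild_A hk).converges (mild_A hl).comp_one_sub

/-- Adding the reflected integral makes the second factor even about 1/2; symmetrisation then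
replaces the first factor by its even part as well. -/
theorem integral_fAA_add_gAA_odd_odd (i j : ℕ) :
    (∫ q in (0 : ℝ)..1, fAA (2 * i + 1) (2 * j + 1) q) +
      ∫ q in (0 : ℝ)..1, gAA (2 * i + 1) (2 * j + 1) q =
      2 * Real.pi ^ 2 * (-1) ^ (i + j) * scale (2 * i + 1) * scale (2 * j + 1) *
        cosIntegral (2 * i + 1) (2 * j + 1) := by
  have hA := mild_A (k := 2 * j + 1) (by omega)
  have h := two_mul_integral_eq (ε := 1) (mild_A (k := 2 * i + 1) (by omega))
    (hA.add hA.comp_one_sub) fun q _ => by rw [sub_sub_cancel]; ring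
  rw [integral_eq_const_mul (f := fun q => (A (2 * i + 1) q + 1 * A (2 * i + 1) (1 - q)) *
      (A (2 * j + 1) q + A (2 * j + 1) (1 - q)) * K q) (g := fun q => cosZeta q (2 * i + 1 : ℕ) *
      cosZeta q (2 * j + 1 : ℕ) * K q)
    (c := 4 * Real.pi ^ 2 * (-1) ^ (i + j) * scale (2 * i + 1) * scale (2 * j + 1))
    fun q hq => by
      rw [one_mul, A_add_A_one_sub i hq, A_add_A_one_sub j hq, pow_add]
      ring] at h
  rw [← intervalIntegral.integral_add (converges_fAA (by omega) (by omega))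
    (converges_gAA (by omega) (by omega)), cosIntegral]
  simp only [fAA, gAA, ← add_mul, ← mul_add]
  linear_combination h / 2

/-- The antisymmetric counterpart: subtracting the reflected integral isolates the odd parts of both
factors. -/
theorem integral_fAA_sub_gAA_even_even {i j : ℕ} (hi : 1 ≤ i) (hj : 1 ≤ j) :
    (∫ q in (0 : ℝ)..1, fAA (2 * i) (2 * j) q) -
      ∫ q in (0 : ℝ)..1, gAA (2 * i) (2 * j) q =
      2 * Real.pi ^ 2 * (-1) ^ (i + j) * scale (2 * i) * scale (2 * j) *
        sinIntegral (2 * i) (2 * j) := by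
  have hA := mild_A (k := 2 * j) (by omega)
  have h := two_mul_integral_eq (ε := -1) (mild_A (k := 2 * i) (by omega))
    (hA.add (hA.comp_one_sub.const_mul (-1))) fun q _ => by rw [sub_sub_cancel]; ring
  rw [integral_eq_const_mul (f := fun q => (A (2 * i) q + -1 * A (2 * i) (1 - q)) *
      (A (2 * j) q + -1 * A (2 * j) (1 - q)) * K q) (g := fun q => sinZeta q (2 * i : ℕ) *
      sinZeta q (2 * j : ℕ) * K q)
    (c := 4 * Real.pi ^ 2 * (-1) ^ (i + j) * scale (2 * i) * scale (2 * j))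
    fun q hq => by
      rw [neg_one_mul, neg_one_mul, ← sub_eq_add_neg, ← sub_eq_add_neg, A_sub_A_one_sub hi q,
        A_sub_A_one_sub hj q, pow_add]
      ring] at h
  rw [← intervalIntegral.integral_sub (converges_fAA (by omega) (by omega))
    (converges_gAA (by omega) (by omega)), sinIntegral]
  simp only [fAA, gAA, ← sub_mul, ← mul_sub]
  simp only [neg_one_mul, ← sub_eq_add_neg] at h
  linear_combination h / 2

theorem cosIntegral_comm (k l : ℕ) : cosIntegral k l = cosIntegral l k := by
  simp only [cosIntegral, mul_comm (cosZeta _ (k : ℂ))]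

theorem sinIntegral_comm (k l : ℕ) : sinIntegral k l = sinIntegral l k := by
  simp only [sinIntegral, mul_comm (sinZeta _ (k : ℂ))]

/-! ### Normalisation and the four parity cases -/

/-- The normalisation of the product of the scales of index `m - 1` and `n`. -/
theorem mul_scale_pred_mul_scale {m : ℕ} (n : ℕ) (hm : 1 ≤ m) :
    (m : ℂ) * (scale (m - 1) * scale n) *
      ((2 * Real.pi : ℂ) ^ (m + n - 1) / ((m.factorial : ℂ) * n.factorial)) = 1 := by
  obtain ⟨k, rfl⟩ : ∃ k, m = k + 1 := ⟨m - 1, by omega⟩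
  have h1 : (k.factorial : ℂ) ≠ 0 := by exact_mod_cast Nat.factorial_ne_zero _
  have h2 : (n.factorial : ℂ) ≠ 0 := by exact_mod_cast Nat.factorial_ne_zero _
  have h3 : ((k : ℂ) + 1) ≠ 0 := Nat.cast_add_one_ne_zero k
  have hm := pow_ne_zero k two_pi_ne_zero'
  have hn := pow_ne_zero n two_pi_ne_zero'
  rw [Nat.add_sub_cancel, show k + 1 + n - 1 = k + n by omega, scale, scale, pow_add,
    Nat.factorial_succ]
  push_cast
  field_simp

theorem pi_ne_zero' : (Real.pi : ℂ) ≠ 0 := by exact_mod_cast Real.pi_ne_zero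

theorem I_AB_odd_even (i : ℕ) {j : ℕ} (hj : 1 ≤ j) :
    I_AB (2 * i + 1) (2 * j) =
      -(2 * (-1) ^ (i + j) * scale (2 * i + 1) * scale (2 * j) *
        cosIntegral (2 * i + 1) (2 * j)) := by
  have := pi_ne_zero'
  rw [I_AB, integral_fAB_odd_even i hj]
  field_simp

theorem I_AB_even_odd {i : ℕ} (hi : 1 ≤ i) (j : ℕ) :
    I_AB (2 * i) (2 * j + 1) =
      2 * (-1) ^ (i + j) * scale (2 * i) * scale (2 * j + 1) *
        sinIntegral (2 * i) (2 * j + 1) := by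
  have := pi_ne_zero'
  rw [I_AB, integral_fAB_even_odd hi j]
  field_simp

theorem I_AA_add_J_AA_odd_odd (i j : ℕ) :
    I_AA (2 * i + 1) (2 * j + 1) + J_AA (2 * i + 1) (2 * j + 1) =
      2 * (-1) ^ (i + j) * scale (2 * i + 1) * scale (2 * j + 1) *
        cosIntegral (2 * i + 1) (2 * j + 1) := by
  have := pi_ne_zero'
  rw [I_AA, J_AA, ← mul_add, integral_fAA_add_gAA_odd_odd i j]
  field_simp

theorem I_AA_sub_J_AA_even_even {i j : ℕ} (hi : 1 ≤ i) (hj : 1 ≤ j) :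
    I_AA (2 * i) (2 * j) - J_AA (2 * i) (2 * j) =
      2 * (-1) ^ (i + j) * scale (2 * i) * scale (2 * j) * sinIntegral (2 * i) (2 * j) := by
  have := pi_ne_zero'
  rw [I_AA, J_AA, ← mul_sub, integral_fAA_sub_gAA_even_even hi hj]
  field_simp

/-- The four parity cases of `ell₂` in a uniform shape. -/
theorem ell₂_eq {m n : ℕ} (hm : 2 ≤ m) (hn : 2 ≤ n) :
    ell₂ m n = 2 * (-1) ^ ((m + n) / 2) *
      (m * (scale (m - 1) * scale n) * cosIntegral (m - 1) n -
        n * (scale (n - 1) * scale m) * sinIntegral m (n - 1)) := by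
  rw [ell₂]
  rcases Nat.even_or_odd' m with ⟨i, rfl | rfl⟩ <;> rcases Nat.even_or_odd' n with ⟨j, rfl | rfl⟩
  · obtain ⟨i, rfl⟩ : ∃ a, i = a + 1 := ⟨i - 1, by omega⟩
    obtain ⟨j, rfl⟩ : ∃ a, j = a + 1 := ⟨j - 1, by omega⟩
    rw [if_pos ⟨even_two_mul _, even_two_mul _⟩, show 2 * (i + 1) - 1 = 2 * i + 1 by omega,
      show 2 * (j + 1) - 1 = 2 * j + 1 by omega, I_AB_odd_even i (by omega),
      I_AB_even_odd (by omega) j,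
      show (2 * (i + 1) + 2 * (j + 1)) / 2 = i + j + 1 + 1 by omega]
    ring
  · obtain ⟨i, rfl⟩ : ∃ a, i = a + 1 := ⟨i - 1, by omega⟩
    have h₁ := I_AA_add_J_AA_odd_odd i j
    have h₂ := I_AA_sub_J_AA_even_even (i := i + 1) (j := j) (by omega) (by omega)
    rw [if_neg (by simp), if_neg (by simp), if_neg (by simp),
      show 2 * (i + 1) - 1 = 2 * i + 1 by omega, Nat.add_sub_cancel,
      show (2 * (i + 1) + (2 * j + 1)) / 2 = i + j + 1 by omega]
    -- Only the sum of I_AA and J_AA at (m-1,n) and their difference at (m,n-1) have closed forms;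
    -- this fixes the signs of the J_AA terms.
    linear_combination -((2 * (i + 1) : ℕ) : ℂ) * h₁ - ((2 * j + 1 : ℕ) : ℂ) * h₂
  · obtain ⟨j, rfl⟩ : ∃ a, j = a + 1 := ⟨j - 1, by omega⟩
    rw [if_neg (by simp), if_neg (by simp), if_pos ⟨odd_two_mul_add_one _, even_two_mul _⟩,
      Nat.add_sub_cancel, show 2 * (j + 1) - 1 = 2 * j + 1 by omega,
      I_BB_even_even (by omega) (by omega), I_BB_odd_odd,
      show (2 * i + 1 + 2 * (j + 1)) / 2 = i + j + 1 by omega]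
    ring
  -- For m and n odd the index that fits A in the cosine integral is n, not m - 1, so the arguments
  -- appear swapped and commutativity restores the order.
  · rw [if_neg (by simp), if_pos ⟨odd_two_mul_add_one _, odd_two_mul_add_one _⟩,
      Nat.add_sub_cancel, Nat.add_sub_cancel, I_AB_odd_even j (by omega),
      I_AB_even_odd (by omega) i, cosIntegral_comm, sinIntegral_comm,
      show (2 * i + 1 + (2 * j + 1)) / 2 = i + j + 1 by omega]
    ring

end Tornheim

end

theorem theorem2p2 (m n : ℕ) (hm : 2 ≤ m) (hn : 2 ≤ n) :
    -- the double series and the integrals in use converge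
    Summable (Tornheim.term m 0 n) ∧
    (Even m → Even n →
      Tornheim.Converges (Tornheim.fAB (m - 1) n) ∧
      Tornheim.Converges (Tornheim.fAB m (n - 1))) ∧
    (Odd m → Odd n →
      Tornheim.Converges (Tornheim.fAB n (m - 1)) ∧
      Tornheim.Converges (Tornheim.fAB (n - 1) m)) ∧
    (Odd m → Even n →
      Tornheim.Converges (Tornheim.fBB (m - 1) n) ∧
      Tornheim.Converges (Tornheim.fBB m (n - 1))) ∧
    (Even m → Odd n →
      Tornheim.Converges (Tornheim.fAA (m - 1) n) ∧
      Tornheim.Converges (Tornheim.fAA m (n - 1)) ∧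
      Tornheim.Converges (Tornheim.gAA (m - 1) n) ∧
      Tornheim.Converges (Tornheim.gAA m (n - 1))) ∧
    -- the evaluation
    ((Tornheim.T m 0 n : ℝ) : ℂ) =
      riemannZeta (m : ℂ) * riemannZeta (n : ℂ) - 1 / 2 * riemannZeta ((m : ℂ) + (n : ℂ))
        + (-1 : ℂ) ^ ((m + n) / 2) *
          ((2 * (Real.pi : ℂ)) ^ (m + n - 1) / ((m.factorial : ℂ) * (n.factorial : ℂ))) *
          Tornheim.ell₂ m n := by
  have hm1 : 1 ≤ m - 1 := by omega
  have hn1 : 1 ≤ n - 1 := by omega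
  have hm0 : 1 ≤ m := by omega
  have hn0 : 1 ≤ n := by omega
  refine ⟨Tornheim.summable_term hm hn, fun _ _ => ⟨?_, ?_⟩, fun _ _ => ⟨?_, ?_⟩,
    fun _ _ => ⟨?_, ?_⟩, fun _ _ => ⟨?_, ?_, ?_, ?_⟩, ?_⟩
  · exact (Tornheim.mild_A hm1).converges (Tornheim.mild_B n)
  · exact (Tornheim.mild_A hm0).converges (Tornheim.mild_B (n - 1))
  · exact (Tornheim.mild_A hn0).converges (Tornheim.mild_B (m - 1))
  · exact (Tornheim.mild_A hn1).converges (Tornheim.mild_B m)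
  · exact (Tornheim.mild_B (m - 1)).converges (Tornheim.mild_B n)
  · exact (Tornheim.mild_B m).converges (Tornheim.mild_B (n - 1))
  · exact Tornheim.converges_fAA hm1 hn0
  · exact Tornheim.converges_fAA hm0 hn1
  · exact Tornheim.converges_gAA hm1 hn0
  · exact Tornheim.converges_gAA hm0 hn1
  · have h₁ := Tornheim.mul_scale_pred_mul_scale n hm0
    have h₂ := Tornheim.mul_scale_pred_mul_scale m hn0
    rw [Nat.add_comm n m, mul_comm (n.factorial : ℂ)] at h₂
    -- The sign in the statement meets the same sign inside `ell₂_eq`, and their product is 1.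
    have hs : ((-1 : ℂ) ^ ((m + n) / 2)) * (-1) ^ ((m + n) / 2) = 1 := by
      rw [← mul_pow]; norm_num
    rw [Tornheim.T_eq_zeta_add_integrals hm hn, Tornheim.ell₂_eq hm hn]
    generalize (2 * (Real.pi : ℂ)) ^ (m + n - 1) / ((m.factorial : ℂ) * (n.factorial : ℂ)) = X at *
    generalize (-1 : ℂ) ^ ((m + n) / 2) = σ at *
    linear_combination -2 * Tornheim.cosIntegral (m - 1) n * (h₁ * σ * σ + hs) +
      2 * Tornheim.sinIntegral m (n - 1) * (h₂ * σ * σ + hs)
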